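/- A knot is a simple closed curve in $\mathbb{R}^3$ (the image of an injective continuous map of the circle). Two knots are equivalent if an orientation-preserving homeomorphism of $\mathbb{R}^3$ maps one onto the other, and a knot is trivial if it is equivalent to a knot lying in a plane. The stick number $s(K)$ is the minimal number of line segments (sticks) of a polygonal knot equivalent to $K$. An arc presentation with $n$ chords is a knot diagram whose projection is a closed curve composed of $n$ chords $l_1,\dots,l_n$ of a round disk $B$, with end points on $\partial B$ (each of these end points being shared by exactly two chords) and with only double points in the interior of $B$, such that whenever $l_i$ and $l_j$ cross in the interior of $B$ and $i<j$, the chord $l_i$ underpasses $l_j$. The arc index $a(K)$ is the minimal number of chords of an arc presentation that represents a knot equivalent to $K$. (A minimum over the empty set is $\infty$.) Theorem. For every nontrivial knot $K$, $$ s(K)\le \tfrac32\,\bigl(a(K)-1\bigr). $$ -/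

import Mathlib

/-- The Euclidean plane. -/
abbrev R2 : Type := EuclideanSpace ℝ (Fin 2)

/-- Euclidean 3-space. -/
abbrev R3 : Type := EuclideanSpace ℝ (Fin 3)

/-- A knot is a simple closed curve embedded in Euclidean 3-space. -/
def IsKnot (K : Set R3) : Prop :=
  ∃ f : Circle → R3, Continuous f ∧ Function.Injective f ∧ Set.range f = K

/-- The self-map `x ↦ h x - h 0` of punctured 3-space induced by a homeomorphism `h`. -/
def puncturedMap (h : R3 ≃ₜ R3) : C({x : R3 // x ≠ 0}, {x : R3 // x ≠ 0}) where
  toFun x := ⟨h x.1 - h 0, fun e => x.2 (h.injective (sub_eq_zero.mp e))⟩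
  continuous_toFun :=
    ((h.continuous.comp continuous_subtype_val).sub continuous_const).subtype_mk _

/-- A homeomorphism `h` of 3-space preserves the orientation if its local degree is `+1`.
As punctured 3-space is homotopy equivalent to the 2-sphere, and self-maps of the sphere are
classified up to homotopy by their degree, this says that `x ↦ h x - h 0` is homotopic to the
identity among the self-maps of punctured 3-space. -/
def OrientationPreserving (h : R3 ≃ₜ R3) : Prop :=
  (puncturedMap h).Homotopic (ContinuousMap.id _)

/-- Two subsets of 3-space (knots, in the applications) are equivalent if an orientation
preserving homeomorphism of 3-space maps one onto the other. -/
def KnotEquiv (K L : Set R3) : Prop :=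
  ∃ h : R3 ≃ₜ R3, OrientationPreserving h ∧ h '' K = L

/-- A knot is trivial if it is equivalent to a knot that lies in a plane. -/
def IsTrivialKnot (K : Set R3) : Prop :=
  ∃ L : Set R3, IsKnot L ∧
    (∃ P : AffineSubspace ℝ R3, Module.finrank ℝ P.direction = 2 ∧ L ⊆ P) ∧ KnotEquiv K L

/-- `L` is a stick knot with `m` sticks: a knot which is the union of `m` nondegenerate line
segments, any two of which meet at most in common end points. -/
def IsStickKnot (m : ℕ) (L : Set R3) : Prop :=
  IsKnot L ∧ ∃ a b : Fin m → R3, (∀ i, a i ≠ b i) ∧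
    (∀ i j, i ≠ j →
      segment ℝ (a i) (b i) ∩ segment ℝ (a j) (b j) ⊆ {a i, b i} ∩ {a j, b j}) ∧
    L = ⋃ i, segment ℝ (a i) (b i)

/-- The stick number: the minimal number of sticks of a stick knot equivalent to `K`
(and `⊤` if there is no such stick knot). -/
noncomputable def stickNumber (K : Set R3) : ℕ∞ :=
  ⨅ (m : ℕ) (_ : ∃ L : Set R3, IsStickKnot m L ∧ KnotEquiv K L), (m : ℕ∞)

/-- A knot diagram made of `n` chords of the unit disk. The closed curve runs through the
points `vertex 0, vertex 1, …, vertex (n - 1), vertex 0` of the unit circle in this order; the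
`k`-th chord that it traverses joins `vertex k` to the cyclically next vertex, and it is the
chord with index `label k` in the numbering of the chords which determines the crossings (of two
crossing chords the one with the smaller index is the underpass). The curve is a knot
projection: its multiple points are double points. (Crossings of distinct chords are
automatically transversal.) -/
structure ArcPresentation (n : ℕ) where
  three_le : 3 ≤ n
  vertex : Fin n → R2
  norm_vertex : ∀ k, ‖vertex k‖ = 1
  vertex_injective : Function.Injective vertex
  label : Equiv.Perm (Fin n)
  no_triple_point : ∀ i j k, i ≠ j → i ≠ k → j ≠ k →
    segment ℝ (vertex i) (vertex (finRotate n i)) ∩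
      segment ℝ (vertex j) (vertex (finRotate n j)) ∩
      segment ℝ (vertex k) (vertex (finRotate n k)) = ∅

namespace ArcPresentation

variable {n : ℕ} (D : ArcPresentation n)

/-- The point of the `k`-th traversed chord at the parameter `t ∈ [0, 1]`. -/
noncomputable def chordPoint (k : Fin n) (t : ℝ) : R2 :=
  AffineMap.lineMap (D.vertex k) (D.vertex (finRotate n k)) t

/-- The closed curve in 3-space over the projection of the diagram whose height above the point
`D.chordPoint k t` of the `k`-th traversed chord is `z k t`. -/
def lift (z : Fin n → ℝ → ℝ) : Set R3 :=
  {x | ∃ k, ∃ t ∈ Set.Icc (0 : ℝ) 1,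
    x = !₂[D.chordPoint k t 0, D.chordPoint k t 1, z k t]}

/-- `z` is a height function which is continuous along the closed curve and agrees with the
diagram: where two chords cross in the interior of the disk, the one with the smaller index is
below. -/
structure IsHeight (z : Fin n → ℝ → ℝ) : Prop where
  continuousOn : ∀ k, ContinuousOn (z k) (Set.Icc 0 1)
  closes_up : ∀ k, z k 1 = z (finRotate n k) 0
  under_over : ∀ i j, D.label i < D.label j →
    ∀ s ∈ Set.Ioo (0 : ℝ) 1, ∀ t ∈ Set.Ioo (0 : ℝ) 1,
      D.chordPoint i s = D.chordPoint j t → z i s < z j t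

/-- The diagram represents the knot `K`: some knot with this diagram is equivalent to `K`. -/
def Represents (K : Set R3) : Prop :=
  ∃ z : Fin n → ℝ → ℝ, D.IsHeight z ∧ KnotEquiv K (D.lift z)

end ArcPresentation

/-- The arc index: the minimal number of chords of an arc presentation that represents `K`
(and `⊤` if there is no such arc presentation). -/
noncomputable def arcIndex (K : Set R3) : ℕ∞ :=
  ⨅ (n : ℕ) (_ : ∃ D : ArcPresentation n, D.Represents K), (n : ℕ∞)

/-! Take an arc presentation with `n = m + 3` chords, numbered along the curve so that the bottom
chord is the edge `0`. It suffices to build an equivalent polygon in which at most `m / 2` edges are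
broken into two sticks, because `2 (m + 3) + m = 3 (n - 1)`.

The other edges get levels that grow geometrically with the label. An edge stays within a bounded
factor of its level over all crossings as soon as one of its ends (or a kink beyond the last
crossing) has exactly that level and the start is positive and not higher. So it is enough to break
the edges `m, m - 2, …` down to `2` or `3`: a broken edge reaches its own level at a kink near its
end, and the short stick after the kink moves to the level of the next edge, which can then be
straight (`exists_heights`). If `m` is odd, the edge `2` follows an unbroken edge; this is harmless
unless its level exceeds both neighbouring levels, and a reflection of the heights excludes that
case.

The bottom edge costs no extra stick. It is first given a very deep kink; then its two straight
neighbours are prolonged beyond the disk in space until the bottom edge joins two points outside, on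
a line missing the disk (`exists_outer_segment`). There it crosses nothing in projection, so its
kink can be straightened (`SlidingPolygon.knotEquiv_knot`). This needs the neighbours not to leave
in opposite directions, which a small perturbation of one vertex achieves.

Equivalences come from two sources. Knots over the same diagram differ by a map that is affine and
increasing on vertical lines (`ArcPresentation.IsHeight.knotEquiv`). Simple polygons in a continuous
family over a connected parameter space are equivalent, since a small displacement of vertices
extends to the identity plus a contraction (`knotEquiv_of_continuous_isSimplePolygon`). -/

/-! ### Orientation-preserving homeomorphisms and equivalence of knots. -/

lemma orientationPreserving_of_isotopy (h : R3 ≃ₜ R3) (H : unitInterval → R3 → R3)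
    (hc : Continuous (Function.uncurry H)) (hinj : ∀ t, Function.Injective (H t))
    (h0 : H 0 = h) (h1 : H 1 = id) : OrientationPreserving h := by
  -- Injectivity of each stage keeps the difference away from `0`; surjectivity of the stages plays
  -- no role.
  refine ⟨⟨⟨fun p => ⟨H p.1 p.2.1 - H p.1 0, fun e => p.2.2 (hinj _ (sub_eq_zero.mp e))⟩, ?_⟩,
    ?_, ?_⟩⟩
  · refine Continuous.subtype_mk (Continuous.sub ?_ ?_) _
    · exact hc.comp (continuous_fst.prodMk (continuous_subtype_val.comp continuous_snd))
    · exact hc.comp (continuous_fst.prodMk continuous_const)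
  · intro x
    apply Subtype.ext
    simp [h0, puncturedMap]
  · intro x
    apply Subtype.ext
    simp [h1]

/-- The two maps differ only in the base point at which `g` is normalised, and `f 0` can be slid to
`0` along a segment. -/
lemma puncturedMap_trans (f g : R3 ≃ₜ R3) :
    (puncturedMap (f.trans g)).Homotopic ((puncturedMap g).comp (puncturedMap f)) := by
  refine ⟨⟨⟨fun p => ⟨g (f p.2.1 - (p.1 : ℝ) • f 0) - g (f 0 - (p.1 : ℝ) • f 0), fun e => p.2.2 ?_⟩,
    ?_⟩, ?_, ?_⟩⟩
  · have := g.injective (sub_eq_zero.mp e)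
    exact f.injective (sub_left_injective this)
  · refine Continuous.subtype_mk ?_ _
    have h1 : Continuous fun p : unitInterval × {x : R3 // x ≠ 0} => f p.2.1 := by fun_prop
    have h2 : Continuous fun p : unitInterval × {x : R3 // x ≠ 0} => (p.1 : ℝ) • f 0 := by fun_prop
    exact (g.continuous.comp (h1.sub h2)).sub (g.continuous.comp (continuous_const.sub h2))
  · intro x
    apply Subtype.ext
    simp [puncturedMap]
  · intro x
    apply Subtype.ext
    simp [puncturedMap]

lemma OrientationPreserving.trans {f g : R3 ≃ₜ R3} (hf : OrientationPreserving f)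
    (hg : OrientationPreserving g) : OrientationPreserving (f.trans g) :=
  (puncturedMap_trans f g).trans (ContinuousMap.Homotopic.comp hg hf)

lemma orientationPreserving_refl : OrientationPreserving (Homeomorph.refl R3) :=
  orientationPreserving_of_isotopy _ (fun _ x => x) (by fun_prop) (fun _ => Function.injective_id)
    rfl rfl

lemma OrientationPreserving.symm {f : R3 ≃ₜ R3} (hf : OrientationPreserving f) :
    OrientationPreserving f.symm := by
  have h1 : (puncturedMap (f.trans f.symm)).Homotopic (ContinuousMap.id _) := by
    rw [Homeomorph.self_trans_symm]
    exact orientationPreserving_refl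
  have h2 : ((puncturedMap f.symm).comp (puncturedMap f)).Homotopic
      ((puncturedMap f.symm).comp (ContinuousMap.id _)) :=
    ContinuousMap.Homotopic.comp (ContinuousMap.Homotopic.refl _) hf
  exact h2.symm.trans ((puncturedMap_trans f f.symm).symm.trans h1)

lemma KnotEquiv.refl (K : Set R3) : KnotEquiv K K :=
  ⟨Homeomorph.refl _, orientationPreserving_refl, by simp⟩

lemma KnotEquiv.trans {K L M : Set R3} (h : KnotEquiv K L) (h' : KnotEquiv L M) :
    KnotEquiv K M := by
  obtain ⟨f, hf, rfl⟩ := h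
  obtain ⟨g, hg, rfl⟩ := h'
  exact ⟨f.trans g, hf.trans hg, by rw [Set.image_image]; rfl⟩

lemma KnotEquiv.symm {K L : Set R3} (h : KnotEquiv K L) : KnotEquiv L K := by
  obtain ⟨f, hf, rfl⟩ := h
  exact ⟨f.symm, hf.symm, by simp [Set.image_image]⟩

lemma IsKnot.of_knotEquiv {K L : Set R3} (hK : IsKnot K) (h : KnotEquiv K L) : IsKnot L := by
  obtain ⟨f, -, rfl⟩ := h
  obtain ⟨k, hk, hi, rfl⟩ := hK
  exact ⟨f ∘ k, f.continuous.comp hk, f.injective.comp hi, Set.range_comp _ _⟩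

open scoped NNReal in
/-- The perturbation of the identity by a strict contraction is isotopic to the identity. -/
lemma exists_orientationPreserving_add {g : R3 → R3} {c : ℝ≥0} (hc : c < 1)
    (hg : LipschitzWith c g) :
    ∃ h : R3 ≃ₜ R3, OrientationPreserving h ∧ ∀ x, h x = x + g x := by
  -- The quantitative inverse function theorem makes a perturbation of the identity with Lipschitz
  -- constant below `1` a homeomorphism; `hN` is its smallness condition, the inverse of the
  -- identity having norm `1`.
  have key : ApproximatesLinearOn (fun x => x + g x)
      ((ContinuousLinearEquiv.refl ℝ R3 : R3 ≃L[ℝ] R3) : R3 →L[ℝ] R3) Set.univ c := by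
    apply LipschitzOnWith.approximatesLinearOn
    rw [lipschitzOnWith_univ]
    convert! hg using 1
    ext1 x
    simp
  have hN : c < ‖((ContinuousLinearEquiv.refl ℝ R3).symm : R3 →L[ℝ] R3)‖₊⁻¹ := by
    have : ‖((ContinuousLinearEquiv.refl ℝ R3).symm : R3 →L[ℝ] R3)‖₊ = 1 := by
      ext
      simp
    rw [this]
    simpa using hc
  refine ⟨key.toHomeomorph _ (Or.inr hN), ?_, fun x => rfl⟩
  refine orientationPreserving_of_isotopy _ (fun t x => x + (1 - (t : ℝ)) • g x) ?_ ?_ ?_ ?_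
  · have := hg.continuous
    fun_prop
  · intro t x y hxy
    by_contra hne
    have h1 : x - y = (1 - (t : ℝ)) • (g y - g x) := by
      have : x + (1 - (t : ℝ)) • g x = y + (1 - (t : ℝ)) • g y := hxy
      rw [smul_sub, sub_eq_sub_iff_add_eq_add, this, add_comm]
    have h2 : ‖x - y‖ ≤ c * ‖x - y‖ := by
      calc ‖x - y‖ = ‖(1 - (t : ℝ)) • (g y - g x)‖ := by rw [← h1]
        _ ≤ 1 * ‖g y - g x‖ := by
          rw [norm_smul]
          gcongr
          rw [Real.norm_eq_abs, abs_le]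
          constructor <;> linarith [t.2.1, t.2.2]
        _ ≤ c * ‖x - y‖ := by
          rw [one_mul, norm_sub_rev x y, ← dist_eq_norm, ← dist_eq_norm]
          exact hg.dist_le_mul _ _
    have h3 : 0 < ‖x - y‖ := norm_pos_iff.mpr (sub_ne_zero.mpr hne)
    have h4 : (c : ℝ) < 1 := by exact_mod_cast hc
    nlinarith
  · ext1 x
    simp
    rfl
  · ext1 x
    simp

/-! ### Stability of simple closed polygons under small perturbations. -/

section Polygon

variable {ι : Type*} (σ : Equiv.Perm ι)

/-- The closed polygons with vertices `q i`, in which `q i` is joined to `q (σ i)`. -/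
def polygonSet (q : ι → R3) : Set R3 := ⋃ i, segment ℝ (q i) (q (σ i))

/-- The point of the edge starting at `q i` at the parameter `s`. -/
noncomputable def edgePoint (q : ι → R3) (i : ι) (s : ℝ) : R3 :=
  AffineMap.lineMap (q i) (q (σ i)) s

/-- A polygon is simple if its half-open edges are nondegenerate and pairwise disjoint. -/
def IsSimplePolygon (q : ι → R3) : Prop :=
  ∀ i j, ∀ s ∈ Set.Ico (0 : ℝ) 1, ∀ t ∈ Set.Ico (0 : ℝ) 1,
    edgePoint σ q i s = edgePoint σ q j t → i = j ∧ s = t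

variable {σ}

lemma mem_polygonSet {q : ι → R3} {x : R3} :
    x ∈ polygonSet σ q ↔ ∃ i, ∃ s ∈ Set.Icc (0 : ℝ) 1, edgePoint σ q i s = x := by
  simp only [polygonSet, Set.mem_iUnion, segment_eq_image_lineMap, Set.mem_image, edgePoint]

lemma edgePoint_zero (q : ι → R3) (i : ι) : edgePoint σ q i 0 = q i := by simp [edgePoint]

lemma edgePoint_one (q : ι → R3) (i : ι) : edgePoint σ q i 1 = q (σ i) := by simp [edgePoint]

lemma edgePoint_eq (q : ι → R3) (i : ι) (s : ℝ) :
    edgePoint σ q i s = q i + s • (q (σ i) - q i) := by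
  simp [edgePoint, AffineMap.lineMap_apply, add_comm]

lemma edgePoint_eq' (q : ι → R3) (i : ι) (s : ℝ) :
    edgePoint σ q i s = q (σ i) - (1 - s) • (q (σ i) - q i) := by
  rw [edgePoint_eq, sub_smul, one_smul]; abel

lemma IsSimplePolygon.ne {q : ι → R3} (hq : IsSimplePolygon σ q) (i : ι) : q i ≠ q (σ i) := by
  intro h
  have := (hq i i 0 (by norm_num) (1 / 2) (by norm_num) (by simp [edgePoint, ← h])).2
  norm_num at this

/-- Closed edges of a simple polygon meet at most in common end points. -/
lemma IsSimplePolygon.adjacent {q : ι → R3} (hq : IsSimplePolygon σ q) {i j : ι} {s t : ℝ}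
    (hs : s ∈ Set.Icc (0 : ℝ) 1) (ht : t ∈ Set.Icc (0 : ℝ) 1)
    (h : edgePoint σ q i s = edgePoint σ q j t) :
    (i = j ∧ s = t) ∨ (s = 1 ∧ t = 0 ∧ j = σ i) ∨ (s = 0 ∧ t = 1 ∧ i = σ j) := by
  rcases hs.2.lt_or_eq with hs1 | rfl <;> rcases ht.2.lt_or_eq with ht1 | rfl
  · exact Or.inl (hq i j s ⟨hs.1, hs1⟩ t ⟨ht.1, ht1⟩ h)
  · rw [edgePoint_one, ← edgePoint_zero (σ := σ) q (σ j)] at h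
    have := hq i (σ j) s ⟨hs.1, hs1⟩ 0 (by norm_num) h
    exact Or.inr (Or.inr ⟨this.2, rfl, this.1⟩)
  · rw [edgePoint_one, ← edgePoint_zero (σ := σ) q (σ i)] at h
    have := hq (σ i) j 0 (by norm_num) t ⟨ht.1, ht1⟩ h
    exact Or.inr (Or.inl ⟨rfl, this.2.symm, this.1.symm⟩)
  · rw [edgePoint_one, edgePoint_one, ← edgePoint_zero (σ := σ) q (σ i),
      ← edgePoint_zero (σ := σ) q (σ j)] at h
    have := hq (σ i) (σ j) 0 (by norm_num) 0 (by norm_num) h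
    exact Or.inl ⟨σ.injective this.1, rfl⟩

/-- Both sides are homogeneous in `(r, s)`, so the minimum over the compact set `r + s = 1` serves
as `c`. -/
lemma exists_pos_le_norm_smul_add_smul {a b : R3}
    (h : ∀ r ∈ Set.Icc (0 : ℝ) 1, r • a + (1 - r) • b ≠ 0) :
    ∃ c > 0, ∀ r s : ℝ, 0 ≤ r → 0 ≤ s → c * (r + s) ≤ ‖r • a + s • b‖ := by
  obtain ⟨r₀, hr₀, hmin⟩ := isCompact_Icc.exists_isMinOn (Set.nonempty_Icc.mpr zero_le_one)
    (f := fun r : ℝ => ‖r • a + (1 - r) • b‖) (s := Set.Icc 0 1) (by fun_prop)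
  refine ⟨_, norm_pos_iff.mpr (h r₀ hr₀), fun r s hr hs => ?_⟩
  rcases (add_nonneg hr hs).eq_or_lt with h0 | h0
  · rw [← h0, mul_zero]; exact norm_nonneg _
  · have h1 := hmin (a := r / (r + s)) ⟨by positivity, by rw [div_le_one h0]; linarith⟩
    have h2 : (r / (r + s)) • a + (1 - r / (r + s)) • b = (r + s)⁻¹ • (r • a + s • b) := by
      rw [smul_add, smul_smul, smul_smul]
      congr 2
      · field_simp
      · field_simp; ring
    simp only [Set.mem_ofPred_eq, h2, norm_smul, norm_inv, Real.norm_eq_abs, abs_of_pos h0] at h1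
    rw [← le_div_iff₀ h0, div_eq_inv_mul]
    exact h1

/-- Near the common vertex both distances tend to zero, so compactness of the edges is not enough.
Simplicity forbids the two edges to leave the vertex in the same direction, whence the distance of
their points is at least a multiple of `(1 - s) + t`, and the displacements differ by at most `2 *
δ` times that quantity. -/
lemma IsSimplePolygon.exists_pair_bound_next {q : ι → R3} (hq : IsSimplePolygon σ q) (i : ι) :
    ∃ C > 0, ∀ e : ι → R3, ∀ δ : ℝ, (∀ i, ‖e i‖ ≤ δ) →
      ∀ s ∈ Set.Icc (0 : ℝ) 1, ∀ t ∈ Set.Icc (0 : ℝ) 1,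
      ‖edgePoint σ e i s - edgePoint σ e (σ i) t‖ ≤
        C * δ * ‖edgePoint σ q i s - edgePoint σ q (σ i) t‖ := by
  obtain ⟨c, hc, hb⟩ := exists_pos_le_norm_smul_add_smul (a := q (σ i) - q i)
    (b := q (σ (σ i)) - q (σ i)) (by
      intro r hr h0
      rcases hr.1.eq_or_lt with rfl | hr0
      · simp only [zero_smul, sub_zero, one_smul, zero_add, sub_eq_zero] at h0
        exact hq.ne _ h0.symm
      · have := (hq i (σ i) (1 - r / 2) ⟨by linarith [hr.2], by linarith⟩ ((1 - r) / 2)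
          ⟨by linarith [hr.2], by linarith⟩ (by
            rw [edgePoint_eq', edgePoint_eq, ← sub_eq_zero]
            have : (1 / 2 : ℝ) • (r • (q (σ i) - q i) + (1 - r) • (q (σ (σ i)) - q (σ i))) = 0 := by
              rw [h0, smul_zero]
            rw [← neg_eq_zero, ← this]
            module)).1
        exact hq.ne i (congrArg q this))
  refine ⟨2 / c, by positivity, fun e δ he s hs t ht => ?_⟩
  have h1 := hb (1 - s) t (by linarith [hs.2]) ht.1
  have h2 : edgePoint σ q i s - edgePoint σ q (σ i) t =
      -((1 - s) • (q (σ i) - q i) + t • (q (σ (σ i)) - q (σ i))) := by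
    rw [edgePoint_eq', edgePoint_eq]; module
  have h3 : edgePoint σ e i s - edgePoint σ e (σ i) t =
      -((1 - s) • (e (σ i) - e i) + t • (e (σ (σ i)) - e (σ i))) := by
    rw [edgePoint_eq', edgePoint_eq]; module
  have hd : ∀ k l, ‖e k - e l‖ ≤ 2 * δ := fun k l =>
    (norm_sub_le _ _).trans (by linarith [he k, he l])
  have hδ : 0 ≤ δ := (norm_nonneg _).trans (he i)
  rw [h2, h3, norm_neg, norm_neg]
  calc _ ≤ (1 - s) * (2 * δ) + t * (2 * δ) := by
        refine (norm_add_le _ _).trans (add_le_add ?_ ?_)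
        · rw [norm_smul, Real.norm_eq_abs, abs_of_nonneg (by linarith [hs.2])]
          exact mul_le_mul_of_nonneg_left (hd _ _) (by linarith [hs.2])
        · rw [norm_smul, Real.norm_eq_abs, abs_of_nonneg ht.1]
          exact mul_le_mul_of_nonneg_left (hd _ _) ht.1
    _ = 2 / c * δ * (c * ((1 - s) + t)) := by field_simp
    _ ≤ _ := mul_le_mul_of_nonneg_left h1 (by positivity)

/-- Besides consecutive edges there are two easy cases: on one edge both sides scale with `|s - t|`,
and two edges without a common vertex have a positive distance. -/
lemma IsSimplePolygon.exists_pair_bound {q : ι → R3} (hq : IsSimplePolygon σ q) (i j : ι) :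
    ∃ C > 0, ∀ e : ι → R3, ∀ δ : ℝ, (∀ i, ‖e i‖ ≤ δ) →
      ∀ s ∈ Set.Icc (0 : ℝ) 1, ∀ t ∈ Set.Icc (0 : ℝ) 1,
      ‖edgePoint σ e i s - edgePoint σ e j t‖ ≤
        C * δ * ‖edgePoint σ q i s - edgePoint σ q j t‖ := by
  by_cases hij : j = σ i
  · subst hij
    exact hq.exists_pair_bound_next i
  by_cases hji : i = σ j
  · subst hji
    obtain ⟨C, hC, h⟩ := hq.exists_pair_bound_next j
    refine ⟨C, hC, fun e δ he s hs t ht => ?_⟩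
    rw [norm_sub_rev, norm_sub_rev (edgePoint σ q _ _)]
    exact h e δ he t ht s hs
  have hd : ∀ e : ι → R3, ∀ δ : ℝ, (∀ i, ‖e i‖ ≤ δ) → ∀ k l, ‖e k - e l‖ ≤ 2 * δ :=
    fun e δ he k l => (norm_sub_le _ _).trans (by linarith [he k, he l])
  by_cases h : i = j
  · subst h
    have h0 : 0 < ‖q (σ i) - q i‖ := norm_pos_iff.mpr (sub_ne_zero.mpr (hq.ne i).symm)
    refine ⟨2 / ‖q (σ i) - q i‖, by positivity, fun e δ he s hs t ht => ?_⟩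
    have h1 : ∀ e : ι → R3, edgePoint σ e i s - edgePoint σ e i t = (s - t) • (e (σ i) - e i) := by
      intro e
      rw [edgePoint_eq, edgePoint_eq]; module
    rw [h1, h1, norm_smul, norm_smul]
    calc _ ≤ ‖s - t‖ * (2 * δ) := by gcongr; exact hd e δ he _ _
      _ = _ := by field_simp
  · obtain ⟨p, hp, hmin⟩ := (isCompact_Icc.prod isCompact_Icc).exists_isMinOn
      ((Set.nonempty_Icc.mpr zero_le_one).prod (Set.nonempty_Icc.mpr zero_le_one))
      (f := fun p : ℝ × ℝ => ‖edgePoint σ q i p.1 - edgePoint σ q j p.2‖)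
      (s := Set.Icc 0 1 ×ˢ Set.Icc 0 1) (by
        simp only [edgePoint_eq]
        fun_prop)
    have h0 : 0 < ‖edgePoint σ q i p.1 - edgePoint σ q j p.2‖ := by
      rw [norm_pos_iff, sub_ne_zero]
      intro h1
      rcases hq.adjacent hp.1 hp.2 h1 with h1 | h1 | h1
      · exact h h1.1
      · exact hij h1.2.2
      · exact hji h1.2.2
    refine ⟨2 / ‖edgePoint σ q i p.1 - edgePoint σ q j p.2‖, by positivity,
      fun e δ he s hs t ht => ?_⟩
    have h1 := hmin (a := (s, t)) ⟨hs, ht⟩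
    simp only [Set.mem_ofPred_eq] at h1
    have hn : ∀ k, ∀ r ∈ Set.Icc (0 : ℝ) 1, ‖edgePoint σ e k r‖ ≤ δ := by
      intro k r hr
      have : edgePoint σ e k r = (1 - r) • e k + r • e (σ k) := by rw [edgePoint_eq]; module
      rw [this]
      refine (norm_add_le _ _).trans ?_
      rw [norm_smul, norm_smul, Real.norm_eq_abs, Real.norm_eq_abs, abs_of_nonneg hr.1,
        abs_of_nonneg (by linarith [hr.2])]
      nlinarith [he k, he (σ k), hr.1, hr.2]
    have hδ : 0 ≤ δ := (norm_nonneg _).trans (he i)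
    calc _ ≤ 2 * δ := (norm_sub_le _ _).trans (by linarith [hn i s hs, hn j t ht])
      _ = 2 / ‖edgePoint σ q i p.1 - edgePoint σ q j p.2‖ * δ *
          ‖edgePoint σ q i p.1 - edgePoint σ q j p.2‖ := by field_simp
      _ ≤ _ := by gcongr

/-- This is Lipschitz continuity, with constant `C * δ`, of the displacement interpolating `e` along
the edges. It also makes that displacement a well-defined function of the point of the polygon. -/
lemma IsSimplePolygon.exists_bound [Finite ι] {q : ι → R3} (hq : IsSimplePolygon σ q) :
    ∃ C > 0, ∀ e : ι → R3, ∀ δ : ℝ, (∀ i, ‖e i‖ ≤ δ) → ∀ i j,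
      ∀ s ∈ Set.Icc (0 : ℝ) 1, ∀ t ∈ Set.Icc (0 : ℝ) 1,
      ‖edgePoint σ e i s - edgePoint σ e j t‖ ≤
        C * δ * ‖edgePoint σ q i s - edgePoint σ q j t‖ := by
  choose C hC h using fun p : ι × ι => hq.exists_pair_bound p.1 p.2
  obtain ⟨B, hB⟩ := (Set.finite_range C).bddAbove
  refine ⟨max B 1, by positivity, fun e δ he i j s hs t ht => ?_⟩
  refine (h (i, j) e δ he s hs t ht).trans ?_
  have h1 : C (i, j) ≤ max B 1 := (hB ⟨_, rfl⟩).trans (le_max_left _ _)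
  have hδ : 0 ≤ δ := (norm_nonneg _).trans (he i)
  gcongr

/-- Sufficiently close simple polygons are equivalent. -/
lemma IsSimplePolygon.exists_knotEquiv_of_close [Finite ι] {q : ι → R3}
    (hq : IsSimplePolygon σ q) : ∃ δ > 0, ∀ q' : ι → R3, (∀ i, ‖q' i - q i‖ ≤ δ) →
      KnotEquiv (polygonSet σ q) (polygonSet σ q') := by
  obtain ⟨C, hC, hb⟩ := hq.exists_bound
  have hN := NNReal.coe_nonneg (lipschitzExtensionConstant R3)
  set N : ℝ := NNReal.toReal (lipschitzExtensionConstant R3)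
  -- Extending a Lipschitz map from the polygon to the whole space costs the factor `N`; this bound
  -- leaves the constant `N / (2 * (N + 1)) < 1`.
  refine ⟨1 / (2 * C * (N + 1)), by positivity, fun q' hq' => ?_⟩
  have hb' := hb (q' - q) _ hq'
  classical
  have hex : ∃ f : R3 → R3, ∀ i, ∀ s ∈ Set.Icc (0 : ℝ) 1,
      f (edgePoint σ q i s) = edgePoint σ (q' - q) i s := by
    refine ⟨fun x => if h : ∃ i, ∃ s ∈ Set.Icc (0 : ℝ) 1, edgePoint σ q i s = x then
      edgePoint σ (q' - q) h.choose h.choose_spec.choose else 0, fun i s hs => ?_⟩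
    have h : ∃ j, ∃ t ∈ Set.Icc (0 : ℝ) 1, edgePoint σ q j t = edgePoint σ q i s :=
      ⟨i, s, hs, rfl⟩
    beta_reduce
    rw [dif_pos h]
    have h1 := hb' h.choose i h.choose_spec.choose h.choose_spec.choose_spec.1 s hs
    rw [h.choose_spec.choose_spec.2, sub_self, norm_zero, mul_zero] at h1
    exact sub_eq_zero.mp (norm_le_zero_iff.mp h1)
  obtain ⟨f, hf⟩ := hex
  have hlip : LipschitzOnWith (Real.toNNReal (C * (1 / (2 * C * (N + 1))))) f (polygonSet σ q) := by
    refine LipschitzOnWith.of_dist_le_mul fun x hx y hy => ?_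
    obtain ⟨i, s, hs, rfl⟩ := mem_polygonSet.mp hx
    obtain ⟨j, t, ht, rfl⟩ := mem_polygonSet.mp hy
    rw [hf i s hs, hf j t ht, dist_eq_norm, dist_eq_norm, Real.coe_toNNReal _ (by positivity)]
    exact hb' i j s hs t ht
  obtain ⟨g, hg, hgf⟩ := hlip.extend_finite_dimension
  obtain ⟨h, ho, hh⟩ := exists_orientationPreserving_add (c := lipschitzExtensionConstant R3 *
    Real.toNNReal (C * (1 / (2 * C * (N + 1))))) (by
      rw [← NNReal.coe_lt_coe, NNReal.coe_mul, Real.coe_toNNReal _ (by positivity), NNReal.coe_one]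
      change N * _ < 1
      have : N * (C * (1 / (2 * C * (N + 1)))) = N / (2 * (N + 1)) := by field_simp
      rw [this, div_lt_one (by positivity)]
      linarith) hg
  refine ⟨h, ho, ?_⟩
  have key : ∀ i, ∀ s ∈ Set.Icc (0 : ℝ) 1, h (edgePoint σ q i s) = edgePoint σ q' i s := by
    intro i s hs
    rw [hh, ← hgf (mem_polygonSet.mpr ⟨i, s, hs, rfl⟩), hf i s hs]
    simp only [edgePoint_eq, Pi.sub_apply]
    module
  ext x
  rw [Set.mem_image, mem_polygonSet]
  constructor
  · rintro ⟨y, hy, rfl⟩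
    obtain ⟨i, s, hs, rfl⟩ := mem_polygonSet.mp hy
    exact ⟨i, s, hs, (key i s hs).symm⟩
  · rintro ⟨i, s, hs, rfl⟩
    exact ⟨_, mem_polygonSet.mpr ⟨i, s, hs, rfl⟩, key i s hs⟩

/-- Simple polygons in a continuous family over a connected space are equivalent. -/
lemma knotEquiv_of_continuous_isSimplePolygon [Finite ι] {X : Type*} [TopologicalSpace X]
    {S : Set X} (hS : IsPreconnected S) {q : X → ι → R3} (hc : ∀ i, ContinuousOn (fun x => q x i) S)
    (hq : ∀ x ∈ S, IsSimplePolygon σ (q x)) {x y : X} (hx : x ∈ S) (hy : y ∈ S) :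
    KnotEquiv (polygonSet σ (q x)) (polygonSet σ (q y)) := by
  refine hS.induction₂ (fun x y => KnotEquiv (polygonSet σ (q x)) (polygonSet σ (q y)))
    (fun x hx => ?_) (fun x y z _ _ _ h h' => h.trans h') (fun x y _ _ h => h.symm) hx hy
  obtain ⟨δ, hδ, h⟩ := (hq x hx).exists_knotEquiv_of_close
  have : ∀ᶠ y in nhdsWithin x S, ∀ i, ‖q y i - q x i‖ ≤ δ := by
    rw [Filter.eventually_all]
    intro i
    filter_upwards [Metric.tendsto_nhds.mp (hc i x hx) δ hδ] with y hy
    rw [← dist_eq_norm]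
    exact hy.le
  filter_upwards [this] with y hy using h _ hy

end Polygon

/-! ### Vertical lines and fibrewise affine homeomorphisms. -/

/-- The point of 3-space over the point `p` of the plane at height `z`. -/
noncomputable def overPoint (p : R2) (z : ℝ) : R3 := !₂[p 0, p 1, z]

/-- The projection of 3-space to the horizontal plane. -/
noncomputable def planeProj (x : R3) : R2 := !₂[x 0, x 1]

@[simp] lemma planeProj_overPoint (p : R2) (z : ℝ) : planeProj (overPoint p z) = p := by
  ext i; fin_cases i <;> simp [planeProj, overPoint]

@[simp] lemma overPoint_two (p : R2) (z : ℝ) : overPoint p z 2 = z := by simp [overPoint]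

@[simp] lemma overPoint_planeProj (x : R3) : overPoint (planeProj x) (x 2) = x := by
  ext i; fin_cases i <;> simp [planeProj, overPoint]

lemma overPoint_inj {p p' : R2} {z z' : ℝ} : overPoint p z = overPoint p' z' ↔ p = p' ∧ z = z' := by
  refine ⟨fun h => ⟨?_, ?_⟩, fun h => by rw [h.1, h.2]⟩
  · simpa using congrArg planeProj h
  · simpa using congrArg (fun x : R3 => x 2) h

lemma continuous_overPoint : Continuous (fun x : R2 × ℝ => overPoint x.1 x.2) := by
  refine (PiLp.continuous_toLp 2 _).comp (continuous_pi fun i => ?_)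
  fin_cases i <;> simp <;> fun_prop

lemma continuous_planeProj : Continuous planeProj := by
  refine (PiLp.continuous_toLp 2 _).comp (continuous_pi fun i => ?_)
  fin_cases i <;> simp <;> fun_prop

lemma lineMap_overPoint (p p' : R2) (z z' s : ℝ) :
    AffineMap.lineMap (overPoint p z) (overPoint p' z') s =
      overPoint (AffineMap.lineMap p p' s) (AffineMap.lineMap z z' s) := by
  ext i; fin_cases i <;> simp [overPoint, AffineMap.lineMap_apply]

/-- The map of 3-space which is affine and increasing on the vertical lines. -/
noncomputable def fiberHomeo (α β : R2 → ℝ) (hα : Continuous α) (hβ : Continuous β)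
    (h0 : ∀ p, 0 < α p) : R3 ≃ₜ R3 where
  toFun x := overPoint (planeProj x) (α (planeProj x) * x 2 + β (planeProj x))
  invFun x := overPoint (planeProj x) ((x 2 - β (planeProj x)) / α (planeProj x))
  left_inv x := by
    have := (h0 (planeProj x)).ne'
    simp only [planeProj_overPoint, overPoint_two]
    rw [add_sub_cancel_right, mul_div_cancel_left₀ _ this, overPoint_planeProj]
  right_inv x := by
    have := (h0 (planeProj x)).ne'
    simp only [planeProj_overPoint, overPoint_two]
    rw [mul_div_cancel₀ _ this, sub_add_cancel, overPoint_planeProj]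
  continuous_toFun := by
    have h1 := hα.comp continuous_planeProj
    have h2 := hβ.comp continuous_planeProj
    have h3 : Continuous fun x : R3 => x 2 := by fun_prop
    exact continuous_overPoint.comp (continuous_planeProj.prodMk ((h1.mul h3).add h2))
  continuous_invFun := by
    have h1 := hα.comp continuous_planeProj
    have h2 := hβ.comp continuous_planeProj
    have h3 : Continuous fun x : R3 => x 2 := by fun_prop
    exact continuous_overPoint.comp
      (continuous_planeProj.prodMk ((h3.sub h2).div h1 fun x => (h0 _).ne'))

/-- Positive slopes form a convex set, so `(α, β)` can be interpolated linearly to `(1, 0)`. -/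
lemma orientationPreserving_fiberHomeo (α β : R2 → ℝ) (hα : Continuous α) (hβ : Continuous β)
    (h0 : ∀ p, 0 < α p) : OrientationPreserving (fiberHomeo α β hα hβ h0) := by
  have hpos : ∀ t : unitInterval, ∀ p, 0 < (1 - (t : ℝ)) * α p + t := by
    intro t p
    rcases t.2.1.eq_or_lt with h | h
    · rw [← h]; simpa using h0 p
    · have := mul_nonneg (sub_nonneg.mpr t.2.2) (h0 p).le
      linarith
  refine orientationPreserving_of_isotopy _ (fun t => fiberHomeo
    (fun p => (1 - (t : ℝ)) * α p + t) (fun p => (1 - (t : ℝ)) * β p)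
    (by fun_prop) (by fun_prop) (hpos t)) ?_ (fun t => (Homeomorph.injective _)) ?_ ?_
  · have h1 : Continuous fun x : unitInterval × R3 => planeProj x.2 :=
      continuous_planeProj.comp continuous_snd
    have h2 := hα.comp h1
    have h3 := hβ.comp h1
    refine continuous_overPoint.comp (h1.prodMk ?_)
    simp only [Function.comp_def] at h2 h3
    fun_prop
  · ext1 x
    simp [fiberHomeo]
  · ext1 x
    simp [fiberHomeo]

section Projection

/-- The parameter of the nearest point of the segment from `a` to `b`. -/
noncomputable def segParam (a b p : R2) : unitInterval :=
  Set.projIcc 0 1 zero_le_one (inner ℝ (b - a) (p - a) / ‖b - a‖ ^ 2)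

lemma continuous_segParam (a b : R2) : Continuous (segParam a b) := by
  unfold segParam
  fun_prop

lemma segParam_lineMap {a b : R2} (hab : a ≠ b) (t : unitInterval) :
    segParam a b (AffineMap.lineMap a b (t : ℝ)) = t := by
  have h : ‖b - a‖ ≠ 0 := norm_ne_zero_iff.mpr (sub_ne_zero.mpr hab.symm)
  have : inner ℝ (b - a) (AffineMap.lineMap a b (t : ℝ) - a) / ‖b - a‖ ^ 2 = t := by
    rw [AffineMap.lineMap_apply, vsub_eq_sub, vadd_eq_add, add_sub_cancel_right, inner_smul_right,
      real_inner_self_eq_norm_sq]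
    field_simp
  rw [segParam, this, Set.projIcc_val]

end Projection

/-! ### Polygons inscribed in the circle, without labels and with triple points allowed. -/

/-- A line meets the unit circle in at most two points. -/
lemma eq_of_sub_eq_smul_sub {v a b : R2} (hv : ‖v‖ = 1) (ha : ‖a‖ = 1) (hb : ‖b‖ = 1) {r : ℝ}
    (hr0 : r ≠ 0) (hbv : b ≠ v) (h2 : a - v = r • (b - v)) : a = b := by
  -- The circle equation in coordinates centred at `v`. Comparing it for `a` and `b` leaves `r * (r
  -- - 1) = 0`.
  have e : ∀ c : R2, ‖c‖ = 1 → 2 * inner ℝ v (c - v) + ‖c - v‖ ^ 2 = 0 := by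
    intro c hc
    have := norm_add_sq_real v (c - v)
    rw [add_sub_cancel, hc, hv] at this
    linarith
  have e1 := e a ha
  have e2 := e b hb
  rw [h2, inner_smul_right, norm_smul, mul_pow, Real.norm_eq_abs, sq_abs] at e1
  have h3 : r * (r - 1) * ‖b - v‖ ^ 2 = 0 := by linear_combination e1 - r * e2
  have h4 : ‖b - v‖ ^ 2 ≠ 0 := pow_ne_zero _ (norm_ne_zero_iff.mpr (sub_ne_zero.mpr hbv))
  have h5 : r = 1 := by
    have := (mul_eq_zero.mp h3).resolve_right h4
    linarith [(mul_eq_zero.mp this).resolve_left hr0]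
  rwa [h5, one_smul, sub_left_inj] at h2

/-- A closed polygon inscribed in the unit circle. -/
structure CirclePolygon (n : ℕ) where
  three_le : 3 ≤ n
  vertex : Fin n → R2
  norm_vertex : ∀ k, ‖vertex k‖ = 1
  vertex_injective : Function.Injective vertex

namespace CirclePolygon

variable {n : ℕ} (D : CirclePolygon n)

/-- The point of the `k`-th chord at the parameter `t`. -/
noncomputable def chordPoint (k : Fin n) (t : ℝ) : R2 :=
  AffineMap.lineMap (D.vertex k) (D.vertex (finRotate n k)) t

lemma finRotate_ne (D : CirclePolygon n) (k : Fin n) : finRotate n k ≠ k := by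
  have := D.three_le
  obtain ⟨m, rfl⟩ : ∃ m, n = m + 2 := ⟨n - 2, by omega⟩
  rw [finRotate_apply]
  simp

lemma finRotate_finRotate_ne (D : CirclePolygon n) (k : Fin n) : finRotate n (finRotate n k) ≠ k := by
  have := D.three_le
  obtain ⟨m, rfl⟩ : ∃ m, n = m + 3 := ⟨n - 3, by omega⟩
  rw [finRotate_apply, finRotate_apply, add_assoc]
  intro h
  have := congrArg Fin.val (add_eq_left.mp h)
  simp [Fin.val_add, Nat.mod_eq_of_lt (show 2 < m + 3 by omega)] at this

lemma vertex_ne (k : Fin n) : D.vertex k ≠ D.vertex (finRotate n k) := fun h =>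
  D.finRotate_ne k (D.vertex_injective h).symm

lemma chordPoint_zero (k : Fin n) : D.chordPoint k 0 = D.vertex k := by simp [chordPoint]

lemma chordPoint_one (k : Fin n) : D.chordPoint k 1 = D.vertex (finRotate n k) := by
  simp [chordPoint]

lemma norm_chordPoint_lt {k : Fin n} {t : ℝ} (ht : t ∈ Set.Ioo (0 : ℝ) 1) :
    ‖D.chordPoint k t‖ < 1 := by
  rw [chordPoint, AffineMap.lineMap_apply_module]
  exact norm_combo_lt_of_ne (D.norm_vertex _).le (D.norm_vertex _).le (D.vertex_ne k)
    (by linarith [ht.2]) ht.1 (by ring)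

lemma norm_chordPoint_eq_one_iff {k : Fin n} {t : ℝ} (ht : t ∈ Set.Icc (0 : ℝ) 1) :
    ‖D.chordPoint k t‖ = 1 ↔ t = 0 ∨ t = 1 := by
  constructor
  · intro h
    by_contra! h'
    exact (D.norm_chordPoint_lt ⟨lt_of_le_of_ne ht.1 h'.1.symm, lt_of_le_of_ne ht.2 h'.2⟩).ne h
  · rintro (rfl | rfl)
    · rw [chordPoint_zero, norm_vertex]
    · rw [chordPoint_one, norm_vertex]

/-- Distinct chords meet in crossings or in common end points. -/
lemma chordPoint_eq {k l : Fin n} (hkl : k ≠ l) {s t : ℝ} (hs : s ∈ Set.Icc (0 : ℝ) 1)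
    (ht : t ∈ Set.Icc (0 : ℝ) 1) (h : D.chordPoint k s = D.chordPoint l t) :
    (s ∈ Set.Ioo (0 : ℝ) 1 ∧ t ∈ Set.Ioo (0 : ℝ) 1) ∨
      (s = 1 ∧ t = 0 ∧ l = finRotate n k) ∨ (s = 0 ∧ t = 1 ∧ k = finRotate n l) := by
  have hiff := (D.norm_chordPoint_eq_one_iff (k := k) hs).symm.trans
    ((h ▸ Iff.rfl : ‖D.chordPoint k s‖ = 1 ↔ ‖D.chordPoint l t‖ = 1).trans
      (D.norm_chordPoint_eq_one_iff ht))
  by_cases h0 : s = 0 ∨ s = 1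
  · right
    rcases h0 with rfl | rfl <;> rcases hiff.mp (by simp) with rfl | rfl <;>
      simp only [chordPoint_zero, chordPoint_one] at h
    · exact absurd (D.vertex_injective h) hkl
    · exact Or.inr ⟨rfl, rfl, D.vertex_injective h⟩
    · exact Or.inl ⟨rfl, rfl, (D.vertex_injective h).symm⟩
    · exact absurd ((finRotate n).injective (D.vertex_injective h)) hkl
  · left
    have h1 : ¬ (t = 0 ∨ t = 1) := fun h => h0 (hiff.mpr h)
    push Not at h0 h1
    exact ⟨⟨lt_of_le_of_ne hs.1 h0.1.symm, lt_of_le_of_ne hs.2 h0.2⟩,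
      ⟨lt_of_le_of_ne ht.1 h1.1.symm, lt_of_le_of_ne ht.2 h1.2⟩⟩

/-- Consecutive chords do not cross. -/
lemma chordPoint_ne_next {k : Fin n} {s t : ℝ} (hs : s ∈ Set.Ioo (0 : ℝ) 1)
    (ht : t ∈ Set.Ioo (0 : ℝ) 1) : D.chordPoint k s ≠ D.chordPoint (finRotate n k) t := by
  intro h
  set v := D.vertex (finRotate n k)
  set a := D.vertex k with ha
  set b := D.vertex (finRotate n (finRotate n k)) with hb
  have h1 : (1 - s) • (a - v) = t • (b - v) := by
    have : AffineMap.lineMap a v s = AffineMap.lineMap v b t := h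
    rw [AffineMap.lineMap_apply_module, AffineMap.lineMap_apply_module] at this
    rw [← sub_eq_zero] at this ⊢
    rw [← this]
    module
  have hs' : 1 - s ≠ 0 := by linarith [hs.2]
  have h2 : a - v = (t / (1 - s)) • (b - v) := by
    rw [div_eq_inv_mul, mul_smul, ← h1, smul_smul, inv_mul_cancel₀ hs', one_smul]
  set r := t / (1 - s) with hr
  have hr0 : r ≠ 0 := div_ne_zero ht.1.ne' hs'
  exact D.finRotate_finRotate_ne k (D.vertex_injective (eq_of_sub_eq_smul_sub
    (D.norm_vertex _) (D.norm_vertex _) (D.norm_vertex _) hr0 (D.vertex_ne _).symm h2)).symm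

/-- The points of the `k`-th chord. -/
def chord (k : Fin n) : Set R2 := segment ℝ (D.vertex k) (D.vertex (finRotate n k))

lemma mem_chord {k : Fin n} {p : R2} :
    p ∈ D.chord k ↔ ∃ t ∈ Set.Icc (0 : ℝ) 1, D.chordPoint k t = p := by
  simp only [chord, segment_eq_image_lineMap, Set.mem_image, chordPoint]

lemma isClosed_chord (k : Fin n) : IsClosed (D.chord k) := by
  have : D.chord k = D.chordPoint k '' Set.Icc 0 1 := by
    ext p; rw [mem_chord]; rfl
  rw [this]
  refine (isCompact_Icc.image ?_).isClosed
  unfold chordPoint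
  exact AffineMap.lineMap_continuous

end CirclePolygon

/-! ### Knots over the same diagram. -/

namespace ArcPresentation

variable {n : ℕ} (D : ArcPresentation n)

/-- The underlying polygon. -/
def circlePolygon : CirclePolygon n :=
  ⟨D.three_le, D.vertex, D.norm_vertex, D.vertex_injective⟩

/-- The points of the `k`-th chord. -/
def chord (k : Fin n) : Set R2 := D.circlePolygon.chord k

lemma mem_chord {k : Fin n} {p : R2} :
    p ∈ D.chord k ↔ ∃ t ∈ Set.Icc (0 : ℝ) 1, D.chordPoint k t = p :=
  D.circlePolygon.mem_chord

lemma isClosed_chord (k : Fin n) : IsClosed (D.chord k) := D.circlePolygon.isClosed_chord k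

lemma vertex_ne (k : Fin n) : D.vertex k ≠ D.vertex (finRotate n k) := D.circlePolygon.vertex_ne k

lemma chordPoint_zero (k : Fin n) : D.chordPoint k 0 = D.vertex k := by simp [chordPoint]

lemma chordPoint_one (k : Fin n) : D.chordPoint k 1 = D.vertex (finRotate n k) := by
  simp [chordPoint]

/-- The extension to the plane of a height function above the `k`-th chord. -/
noncomputable def extHeight (z : Fin n → ℝ → ℝ) (k : Fin n) (p : R2) : ℝ :=
  z k (segParam (D.vertex k) (D.vertex (finRotate n k)) p)

variable {D}

lemma extHeight_chordPoint (z : Fin n → ℝ → ℝ) (k : Fin n) {t : ℝ} (ht : t ∈ Set.Icc (0 : ℝ) 1) :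
    D.extHeight z k (D.chordPoint k t) = z k t := by
  rw [extHeight, chordPoint, segParam_lineMap (D.vertex_ne k) ⟨t, ht⟩]

lemma IsHeight.continuous_extHeight {z : Fin n → ℝ → ℝ} (hz : D.IsHeight z) (k : Fin n) :
    Continuous (D.extHeight z k) :=
  (continuousOn_iff_continuous_domRestrict.mp (hz.continuousOn k)).comp (continuous_segParam _ _)

lemma IsHeight.extHeight_lt {z : Fin n → ℝ → ℝ} (hz : D.IsHeight z) {k l : Fin n}
    (hkl : D.label k < D.label l) {s t : ℝ} (hs : s ∈ Set.Ioo (0 : ℝ) 1)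
    (ht : t ∈ Set.Ioo (0 : ℝ) 1) (h : D.chordPoint k s = D.chordPoint l t) :
    D.extHeight z k (D.chordPoint k s) < D.extHeight z l (D.chordPoint k s) := by
  rw [extHeight_chordPoint _ _ (Set.Ioo_subset_Icc_self hs), h,
    extHeight_chordPoint _ _ (Set.Ioo_subset_Icc_self ht)]
  exact hz.under_over k l hkl s hs t ht h

/-- At most two chords pass through `p`, which is what an affine map of a line can accommodate. Over
one chord a translation suffices; at a crossing two pairs of heights determine the map, and its
slope is positive because both height functions order the chords by label; at a vertex the two
translations agree and are glued. -/
lemma exists_local_fiber {z z' : Fin n → ℝ → ℝ} (hz : D.IsHeight z) (hz' : D.IsHeight z')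
    (p : R2) : ∃ U ∈ nhds p, ∃ α β : R2 → ℝ, ContinuousOn α U ∧ ContinuousOn β U ∧
      ∀ x ∈ U, 0 < α x ∧ ∀ k, p ∈ D.chord k → x ∈ D.chord k →
        α x * D.extHeight z k x + β x = D.extHeight z' k x := by
  by_cases h0 : ∃ k, p ∈ D.chord k
  swap
  · push Not at h0
    exact ⟨Set.univ, Filter.univ_mem, fun _ => 1, fun _ => 0, continuousOn_const,
      continuousOn_const, fun x _ => ⟨one_pos, fun k hk => absurd hk (h0 k)⟩⟩
  obtain ⟨k, hk⟩ := h0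
  by_cases h1 : ∃ l, l ≠ k ∧ p ∈ D.chord l
  swap
  · push Not at h1
    refine ⟨Set.univ, Filter.univ_mem, fun _ => 1,
      fun x => D.extHeight z' k x - D.extHeight z k x, continuousOn_const,
      ((hz'.continuous_extHeight k).sub (hz.continuous_extHeight k)).continuousOn,
      fun x _ => ⟨one_pos, fun l hl _ => ?_⟩⟩
    have : l = k := by
      by_contra h
      exact h1 l h hl
    subst this
    ring
  obtain ⟨l, hlk, hl⟩ := h1
  have h2 : ∀ m, p ∈ D.chord m → m = k ∨ m = l := by
    intro m hm
    by_contra! h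
    have := D.no_triple_point k l m hlk.symm h.1.symm h.2.symm
    exact (this ▸ ⟨⟨hk, hl⟩, hm⟩ : p ∈ (∅ : Set R2))
  -- the common cases, up to exchanging `k` and `l`
  have hcross : ∀ k l : Fin n, (∀ m, p ∈ D.chord m → m = k ∨ m = l) → ∀ s ∈ Set.Ioo (0 : ℝ) 1,
      ∀ t ∈ Set.Ioo (0 : ℝ) 1, D.chordPoint k s = p → D.chordPoint l t = p →
      D.label k < D.label l → ∃ U ∈ nhds p, ∃ α β : R2 → ℝ, ContinuousOn α U ∧ ContinuousOn β U ∧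
      ∀ x ∈ U, 0 < α x ∧ ∀ k, p ∈ D.chord k → x ∈ D.chord k →
        α x * D.extHeight z k x + β x = D.extHeight z' k x := by
    intro k l h2 s hs t ht hks hlt hlab
    have c1 := hz.continuous_extHeight k
    have c2 := hz.continuous_extHeight l
    have c3 := hz'.continuous_extHeight k
    have c4 := hz'.continuous_extHeight l
    have l1 := hz.extHeight_lt hlab hs ht (hks.trans hlt.symm)
    have l2 := hz'.extHeight_lt hlab hs ht (hks.trans hlt.symm)
    rw [hks] at l1 l2
    refine ⟨{x | D.extHeight z k x < D.extHeight z l x} ∩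
      {x | D.extHeight z' k x < D.extHeight z' l x},
      Filter.inter_mem ((isOpen_lt c1 c2).mem_nhds l1) ((isOpen_lt c3 c4).mem_nhds l2),
      fun x => (D.extHeight z' l x - D.extHeight z' k x) / (D.extHeight z l x - D.extHeight z k x),
      fun x => D.extHeight z' k x - (D.extHeight z' l x - D.extHeight z' k x) /
        (D.extHeight z l x - D.extHeight z k x) * D.extHeight z k x, ?_, ?_, ?_⟩
    · exact (c4.sub c3).continuousOn.div (c2.sub c1).continuousOn
        fun x hx => (sub_pos.mpr hx.1).ne'
    · exact c3.continuousOn.sub (((c4.sub c3).continuousOn.div (c2.sub c1).continuousOn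
        fun x hx => (sub_pos.mpr hx.1).ne').mul c1.continuousOn)
    · intro x hx
      refine ⟨div_pos (sub_pos.mpr hx.2) (sub_pos.mpr hx.1), fun m hm _ => ?_⟩
      have : D.extHeight z l x - D.extHeight z k x ≠ 0 := (sub_pos.mpr hx.1).ne'
      rcases h2 m hm with rfl | rfl
      · ring
      · field_simp
        ring
  have hvert : ∀ k l : Fin n, (∀ m, p ∈ D.chord m → m = k ∨ m = l) → l ≠ k →
      l = finRotate n k → p = D.vertex l → ∃ U ∈ nhds p, ∃ α β : R2 → ℝ,
      ContinuousOn α U ∧ ContinuousOn β U ∧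
      ∀ x ∈ U, 0 < α x ∧ ∀ k, p ∈ D.chord k → x ∈ D.chord k →
        α x * D.extHeight z k x + β x = D.extHeight z' k x := by
    intro k l h2 hlk hnext hp
    have c1 := (hz'.continuous_extHeight k).sub (hz.continuous_extHeight k)
    have c2 := (hz'.continuous_extHeight l).sub (hz.continuous_extHeight l)
    have hends : ∀ z : Fin n → ℝ → ℝ, D.IsHeight z → D.extHeight z k p = D.extHeight z l p := by
      intro z hz
      have e1 := extHeight_chordPoint (D := D) z k (t := 1) (by norm_num)
      have e2 := extHeight_chordPoint (D := D) z l (t := 0) (by norm_num)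
      rw [chordPoint_one, ← hnext, ← hp] at e1
      rw [chordPoint_zero, ← hp] at e2
      rw [e1, e2, hz.closes_up k, hnext]
    by_cases hdup : (D.chord k ∩ D.chord l) ⊆ {p}
    swap
    · exfalso
      apply hdup
      rintro x ⟨hxk, hxl⟩
      obtain ⟨s, hs, hks⟩ := D.mem_chord.mp hxk
      obtain ⟨t, ht, hlt⟩ := D.mem_chord.mp hxl
      rcases D.circlePolygon.chordPoint_eq hlk.symm hs ht (hks.trans hlt.symm) with h | h | h
      · exact absurd (hks.trans hlt.symm) (hnext ▸ D.circlePolygon.chordPoint_ne_next h.1 h.2)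
      · rw [Set.mem_singleton_iff, hp, ← hlt, h.2.1, chordPoint_zero]
      · exact absurd (hnext ▸ h.2.2).symm (D.circlePolygon.finRotate_finRotate_ne k)
    classical
    -- The shifts over the two closed chords agree at their only common point `p`, so they form one
    -- continuous function, which Tietze's theorem extends to the plane.
    set F : R2 → ℝ := fun x => if x ∈ D.chord k then D.extHeight z' k x - D.extHeight z k x
      else D.extHeight z' l x - D.extHeight z l x with hF
    have hFl : Set.EqOn F (fun x => D.extHeight z' l x - D.extHeight z l x) (D.chord l) := by
      intro x hx
      by_cases hxk : x ∈ D.chord k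
      · obtain rfl : x = p := hdup ⟨hxk, hx⟩
        simp only [hF, if_pos hxk, hends z hz, hends z' hz']
      · simp only [hF, if_neg hxk]
    have hFk : Set.EqOn F (fun x => D.extHeight z' k x - D.extHeight z k x) (D.chord k) := by
      intro x hx
      simp only [hF, if_pos hx]
    have hFc : ContinuousOn F (D.chord k ∪ D.chord l) :=
      (c1.continuousOn.congr hFk).union_of_isClosed (c2.continuousOn.congr hFl)
        (D.isClosed_chord k) (D.isClosed_chord l)
    obtain ⟨G, hG⟩ := ContinuousMap.exists_restrict_eq
      ((D.isClosed_chord k).union (D.isClosed_chord l)) ⟨_, continuousOn_iff_continuous_domRestrict.mp hFc⟩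
    have hG' : ∀ x ∈ D.chord k ∪ D.chord l, G x = F x := fun x hx =>
      congrArg (fun f => f ⟨x, hx⟩) hG
    refine ⟨Set.univ, Filter.univ_mem, fun _ => 1, G, continuousOn_const,
      G.continuous.continuousOn, fun x _ => ⟨one_pos, fun m hm hx => ?_⟩⟩
    rcases h2 m hm with rfl | rfl
    · rw [hG' x (Or.inl hx), hFk hx]; ring
    · rw [hG' x (Or.inr hx), hFl hx]; ring
  obtain ⟨s, hs, hks⟩ := D.mem_chord.mp hk
  obtain ⟨t, ht, hlt⟩ := D.mem_chord.mp hl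
  rcases D.circlePolygon.chordPoint_eq hlk.symm hs ht (hks.trans hlt.symm) with h | h | h
  · rcases lt_trichotomy (D.label k) (D.label l) with hlab | hlab | hlab
    · exact hcross k l h2 s h.1 t h.2 hks hlt hlab
    · exact absurd (D.label.injective hlab).symm hlk
    · exact hcross l k (fun m hm => (h2 m hm).symm) t h.2 s h.1 hlt hks hlab
  · refine hvert k l h2 hlk h.2.2 ?_
    rw [← hlt, h.2.1, chordPoint_zero]
  · refine hvert l k (fun m hm => (h2 m hm).symm) hlk.symm h.2.2 ?_
    rw [← hks, h.1, chordPoint_zero]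

/-- Knots with the same diagram are equivalent. -/
lemma IsHeight.knotEquiv {z z' : Fin n → ℝ → ℝ} (hz : D.IsHeight z) (hz' : D.IsHeight z') :
    KnotEquiv (D.lift z) (D.lift z') := by
  -- Over each point the admissible pairs (slope, shift) form a convex set, so a partition of unity
  -- glues local choices.
  obtain ⟨g, hg⟩ := exists_continuous_forall_mem_convex_of_local (X := R2) (E := ℝ × ℝ)
    (t := fun x => {ab | 0 < ab.1 ∧ ∀ k, x ∈ D.chord k →
      ab.1 * D.extHeight z k x + ab.2 = D.extHeight z' k x}) (by
      intro x a ha b hb r s hr hs hrs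
      refine ⟨?_, fun k hk => ?_⟩
      · have h1 := ha.1
        have h2 := hb.1
        simp only [Prod.fst_add, Prod.smul_fst, smul_eq_mul]
        rcases hr.eq_or_lt with rfl | hr'
        · simp only [zero_add] at hrs
          rw [hrs]; linarith
        · have := mul_pos hr' h1
          have := mul_nonneg hs h2.le
          linarith
      · have h1 := ha.2 k hk
        have h2 := hb.2 k hk
        simp only [Prod.fst_add, Prod.smul_fst, smul_eq_mul, Prod.snd_add, Prod.smul_snd]
        linear_combination r * h1 + s * h2 + D.extHeight z' k x * hrs) (by
      intro p
      obtain ⟨U, hU, α, β, hα, hβ, h⟩ := exists_local_fiber hz hz' p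
      -- Removing the finitely many closed chords that miss `p` leaves only the conditions met by
      -- the local choice.
      refine ⟨U ∩ ⋂ k ∈ {k | p ∉ D.chord k}, (D.chord k)ᶜ, Filter.inter_mem hU ?_,
        fun x => (α x, β x), (hα.prodMk hβ).mono Set.inter_subset_left, fun x hx => ?_⟩
      · rw [Filter.biInter_mem (Set.toFinite _)]
        exact fun k hk => (D.isClosed_chord k).isOpen_compl.mem_nhds hk
      · refine ⟨(h x hx.1).1, fun k hk => (h x hx.1).2 k ?_ hk⟩
        by_contra hp
        exact Set.mem_iInter₂.mp hx.2 k hp hk)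
  refine ⟨fiberHomeo (fun x => (g x).1) (fun x => (g x).2) (by fun_prop) (by fun_prop)
    fun p => (hg p).1, orientationPreserving_fiberHomeo _ _ _ _ _, ?_⟩
  have key : ∀ k, ∀ t ∈ Set.Icc (0 : ℝ) 1,
      fiberHomeo (fun x => (g x).1) (fun x => (g x).2) (by fun_prop) (by fun_prop)
        (fun p => (hg p).1) (overPoint (D.chordPoint k t) (z k t)) =
      overPoint (D.chordPoint k t) (z' k t) := by
    intro k t ht
    have := (hg (D.chordPoint k t)).2 k (D.mem_chord.mpr ⟨t, ht, rfl⟩)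
    rw [extHeight_chordPoint _ _ ht, extHeight_chordPoint _ _ ht] at this
    simp [fiberHomeo, this]
  ext x
  constructor
  · rintro ⟨y, ⟨k, t, ht, rfl⟩, rfl⟩
    exact ⟨k, t, ht, key k t ht⟩
  · rintro ⟨k, t, ht, rfl⟩
    exact ⟨_, ⟨k, t, ht, rfl⟩, key k t ht⟩

end ArcPresentation

/-! ### Heights along an edge broken once. -/

/-- The height of a broken line over `[0, 1]` with the heights `a`, `κ`, `b` at `0`, `τ`, `1`. -/
noncomputable def plHeight (τ a κ b r : ℝ) : ℝ :=
  if r ≤ τ then AffineMap.lineMap a κ (r / τ) else AffineMap.lineMap κ b ((r - τ) / (1 - τ))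

section plHeight

variable {τ : ℝ} (h0 : 0 < τ) (h1 : τ < 1) (a κ b : ℝ)

lemma plHeight_of_le {r : ℝ} (hr : r ≤ τ) : plHeight τ a κ b r = a + r / τ * (κ - a) := by
  rw [plHeight, if_pos hr, AffineMap.lineMap_apply, smul_eq_mul, vsub_eq_sub, vadd_eq_add, add_comm]

include h0 h1 in
lemma plHeight_of_ge {r : ℝ} (hr : τ ≤ r) :
    plHeight τ a κ b r = b - (1 - r) / (1 - τ) * (b - κ) := by
  have : 1 - τ ≠ 0 := by linarith
  rcases hr.eq_or_lt with rfl | hr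
  · rw [plHeight_of_le _ _ _ le_rfl]
    field_simp
    ring
  · rw [plHeight, if_neg hr.not_ge, AffineMap.lineMap_apply, smul_eq_mul, vsub_eq_sub, vadd_eq_add]
    field_simp
    ring

include h0 in
lemma plHeight_zero : plHeight τ a κ b 0 = a := by
  rw [plHeight_of_le _ _ _ h0.le]; simp

include h0 h1 in
lemma plHeight_one : plHeight τ a κ b 1 = b := by
  rw [plHeight_of_ge h0 h1 _ _ _ h1.le]; simp

-- A kink on the straight line is no kink. This allows straight and broken edges to be treated
-- uniformly, every edge carrying a formal kink at `τ`.
include h0 h1 in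
lemma plHeight_straight (r : ℝ) :
    plHeight τ a (AffineMap.lineMap a b τ) b r = AffineMap.lineMap a b r := by
  have h2 : 1 - τ ≠ 0 := by linarith
  rcases le_total r τ with hr | hr
  · rw [plHeight_of_le _ _ _ hr]
    simp only [AffineMap.lineMap_apply, smul_eq_mul, vsub_eq_sub, vadd_eq_add]
    field_simp
    ring
  · rw [plHeight_of_ge h0 h1 _ _ _ hr]
    simp only [AffineMap.lineMap_apply, smul_eq_mul, vsub_eq_sub, vadd_eq_add]
    field_simp
    ring

include h0 h1 in
lemma continuous_plHeight : Continuous (plHeight τ a κ b) := by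
  have h2 : 1 - τ ≠ 0 := by linarith
  have : plHeight τ a κ b = fun r => if r ≤ τ then a + r / τ * (κ - a) else
      b - (1 - r) / (1 - τ) * (b - κ) := by
    ext r
    split_ifs with hr
    · exact plHeight_of_le _ _ _ hr
    · exact plHeight_of_ge h0 h1 _ _ _ (not_le.mp hr).le
  rw [this]
  refine Continuous.if_le (by fun_prop) (by fun_prop) continuous_id continuous_const ?_
  rintro r rfl
  field_simp
  ring

include h0 h1 in
lemma abs_plHeight_le {S r : ℝ} (hr : r ∈ Set.Icc (0 : ℝ) 1) {a κ b : ℝ} (ha : |a| ≤ S)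
    (hκ : |κ| ≤ S) (hb : |b| ≤ S) : |plHeight τ a κ b r| ≤ S := by
  rcases le_total r τ with h | h
  · have e : plHeight τ a κ b r = (1 - r / τ) * a + r / τ * κ := by
      rw [plHeight_of_le _ _ _ h]; ring
    have hs0 : 0 ≤ r / τ := div_nonneg hr.1 h0.le
    have hs1 : r / τ ≤ 1 := (div_le_one h0).mpr h
    rw [e]
    generalize r / τ = s at *
    rw [abs_le] at *
    constructor <;> nlinarith
  · have e : plHeight τ a κ b r = (1 - (1 - r) / (1 - τ)) * b + (1 - r) / (1 - τ) * κ := by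
      rw [plHeight_of_ge h0 h1 _ _ _ h]; ring
    have hs0 : 0 ≤ (1 - r) / (1 - τ) := div_nonneg (by linarith [hr.2]) (by linarith)
    have hs1 : (1 - r) / (1 - τ) ≤ 1 := (div_le_one (by linarith)).mpr (by linarith)
    rw [e]
    generalize (1 - r) / (1 - τ) = s at *
    rw [abs_le] at *
    constructor <;> nlinarith

end plHeight

/-! ### Space polygons whose edges are broken once. -/

/-- The cyclic permutation of the vertices of an `n`-gon whose edges are broken once. -/
def kinkPerm (n : ℕ) : Equiv.Perm (Fin n × Bool) where
  toFun i := if i.2 then (finRotate n i.1, false) else (i.1, true)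
  invFun i := if i.2 then (i.1, false) else ((finRotate n).symm i.1, true)
  left_inv i := by rcases i with ⟨k, _ | _⟩ <;> simp [-finRotate_apply]
  right_inv i := by
    rcases i with ⟨k, _ | _⟩
    · exact Prod.ext ((finRotate n).apply_symm_apply k) rfl
    · rfl

section Kink

variable {n : ℕ} (P : Fin n → R2) (τ : ℝ) (a κ : Fin n → ℝ)

/-- The polygon in space over the planar polygon `P` with heights `a` at the vertices and heights
`κ` at the parameter `τ` of the edges. -/
noncomputable def kinkPolygon (i : Fin n × Bool) : R3 :=
  if i.2 then overPoint (AffineMap.lineMap (P i.1) (P (finRotate n i.1)) τ) (κ i.1)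
  else overPoint (P i.1) (a i.1)

/-- The point at the parameter `r` of the `k`-th edge, which is broken at `τ`. -/
noncomputable def kinkPoint (k : Fin n) (r : ℝ) : R3 :=
  overPoint (AffineMap.lineMap (P k) (P (finRotate n k)) r)
    (plHeight τ (a k) (κ k) (a (finRotate n k)) r)

lemma kinkPerm_false (k : Fin n) : kinkPerm n (k, false) = (k, true) := rfl

lemma kinkPerm_true (k : Fin n) : kinkPerm n (k, true) = (finRotate n k, false) := rfl

lemma kinkPolygon_false (k : Fin n) : kinkPolygon P τ a κ (k, false) = overPoint (P k) (a k) := rfl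

lemma kinkPolygon_true (k : Fin n) : kinkPolygon P τ a κ (k, true) =
    overPoint (AffineMap.lineMap (P k) (P (finRotate n k)) τ) (κ k) := rfl

variable {P τ a κ} (h0 : 0 < τ) (h1 : τ < 1)

include h0 in
lemma edgePoint_kink_false (k : Fin n) {s : ℝ} (hs : s ≤ 1) :
    edgePoint (kinkPerm n) (kinkPolygon P τ a κ) (k, false) s = kinkPoint P τ a κ k (s * τ) := by
  have h : s * τ ≤ τ := mul_le_of_le_one_left h0.le hs
  simp only [edgePoint, kinkPerm_false, kinkPolygon_false, kinkPolygon_true,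
    kinkPoint, lineMap_overPoint, plHeight_of_le _ _ _ h, overPoint_inj]
  constructor
  · simp only [AffineMap.lineMap_apply, vsub_eq_sub, vadd_eq_add]
    module
  · rw [mul_div_cancel_right₀ _ h0.ne', AffineMap.lineMap_apply, smul_eq_mul, vsub_eq_sub,
      vadd_eq_add, add_comm]

include h0 h1 in
lemma edgePoint_kink_true (k : Fin n) {s : ℝ} (hs : 0 ≤ s) :
    edgePoint (kinkPerm n) (kinkPolygon P τ a κ) (k, true) s =
      kinkPoint P τ a κ k (τ + s * (1 - τ)) := by
  have h : τ ≤ τ + s * (1 - τ) := by nlinarith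
  have h2 : 1 - τ ≠ 0 := by linarith
  simp only [edgePoint, kinkPerm_true, kinkPolygon_false, kinkPolygon_true,
    kinkPoint, lineMap_overPoint, plHeight_of_ge h0 h1 _ _ _ h, overPoint_inj]
  constructor
  · simp only [AffineMap.lineMap_apply, vsub_eq_sub, vadd_eq_add]
    module
  · rw [AffineMap.lineMap_apply, smul_eq_mul, vsub_eq_sub, vadd_eq_add]
    field_simp
    ring

include h0 h1 in
lemma mem_polygonSet_kink {x : R3} : x ∈ polygonSet (kinkPerm n) (kinkPolygon P τ a κ) ↔
    ∃ k, ∃ r ∈ Set.Icc (0 : ℝ) 1, kinkPoint P τ a κ k r = x := by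
  rw [mem_polygonSet]
  have h2 : 0 < 1 - τ := by linarith
  constructor
  · rintro ⟨⟨k, _ | _⟩, s, hs, rfl⟩
    · refine ⟨k, s * τ, ⟨mul_nonneg hs.1 h0.le, ?_⟩, (edgePoint_kink_false h0 k hs.2).symm⟩
      nlinarith [hs.2]
    · refine ⟨k, τ + s * (1 - τ), ⟨?_, ?_⟩, (edgePoint_kink_true h0 h1 k hs.1).symm⟩ <;>
        nlinarith [hs.1, hs.2]
  · rintro ⟨k, r, hr, rfl⟩
    rcases le_total r τ with h | h
    · refine ⟨(k, false), r / τ, ⟨div_nonneg hr.1 h0.le, (div_le_one h0).mpr h⟩, ?_⟩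
      rw [edgePoint_kink_false h0 k ((div_le_one h0).mpr h), div_mul_cancel₀ _ h0.ne']
    · refine ⟨(k, true), (r - τ) / (1 - τ), ⟨div_nonneg (by linarith) h2.le,
        (div_le_one h2).mpr (by linarith [hr.2])⟩, ?_⟩
      rw [edgePoint_kink_true h0 h1 k (div_nonneg (by linarith) h2.le), div_mul_cancel₀ _ h2.ne',
        add_sub_cancel]

/-- The broken edges are pairwise disjoint as long as they have different heights wherever their
projections meet. -/
def KinkGeneric (P : Fin n → R2) (τ : ℝ) (a κ : Fin n → ℝ) : Prop :=
  (∀ k, P k ≠ P (finRotate n k)) ∧ ∀ k l, k ≠ l → ∀ r ∈ Set.Ico (0 : ℝ) 1, ∀ s ∈ Set.Ico (0 : ℝ) 1,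
    AffineMap.lineMap (P k) (P (finRotate n k)) r = AffineMap.lineMap (P l) (P (finRotate n l)) s →
    plHeight τ (a k) (κ k) (a (finRotate n k)) r ≠ plHeight τ (a l) (κ l) (a (finRotate n l)) s

lemma KinkGeneric.kinkPoint_eq (hg : KinkGeneric P τ a κ) {k l : Fin n} {r s : ℝ}
    (hr : r ∈ Set.Ico (0 : ℝ) 1) (hs : s ∈ Set.Ico (0 : ℝ) 1)
    (h : kinkPoint P τ a κ k r = kinkPoint P τ a κ l s) : k = l ∧ r = s := by
  have h := overPoint_inj.mp h
  by_cases hkl : k = l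
  · subst hkl
    exact ⟨rfl, AffineMap.lineMap_injective ℝ (hg.1 k) h.1⟩
  · exact absurd h.2 (hg.2 k l hkl r hr s hs h.1)

include h0 h1 in
lemma kinkPoint_one (k : Fin n) : kinkPoint P τ a κ k 1 = kinkPoint P τ a κ (finRotate n k) 0 := by
  simp [kinkPoint, plHeight_zero h0, plHeight_one h0 h1]

include h0 h1 in
lemma KinkGeneric.kinkPoint_eq' (hg : KinkGeneric P τ a κ) {k l : Fin n} {r s : ℝ}
    (hr : r ∈ Set.Icc (0 : ℝ) 1) (hs : s ∈ Set.Icc (0 : ℝ) 1)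
    (h : kinkPoint P τ a κ k r = kinkPoint P τ a κ l s) :
    (k = l ∧ r = s) ∨ (r = 1 ∧ s = 0) ∨ (r = 0 ∧ s = 1) := by
  rcases hr.2.lt_or_eq with hr1 | rfl <;> rcases hs.2.lt_or_eq with hs1 | rfl
  · exact Or.inl (hg.kinkPoint_eq ⟨hr.1, hr1⟩ ⟨hs.1, hs1⟩ h)
  · rw [kinkPoint_one h0 h1 l] at h
    exact Or.inr (Or.inr ⟨(hg.kinkPoint_eq ⟨hr.1, hr1⟩ (by norm_num) h).2, rfl⟩)
  · rw [kinkPoint_one h0 h1 k] at h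
    exact Or.inr (Or.inl ⟨rfl, (hg.kinkPoint_eq (by norm_num) ⟨hs.1, hs1⟩ h).2.symm⟩)
  · rw [kinkPoint_one h0 h1 k, kinkPoint_one h0 h1 l] at h
    exact Or.inl ⟨(finRotate n).injective (hg.kinkPoint_eq (by norm_num) (by norm_num) h).1, rfl⟩

include h0 h1 in
lemma KinkGeneric.isSimplePolygon (hg : KinkGeneric P τ a κ) :
    IsSimplePolygon (kinkPerm n) (kinkPolygon P τ a κ) := by
  have h2 : 0 < 1 - τ := by linarith
  have e1 : ∀ {s : ℝ}, s ∈ Set.Ico (0 : ℝ) 1 → s * τ ∈ Set.Ico (0 : ℝ) 1 ∧ s * τ < τ :=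
    fun hs => ⟨⟨mul_nonneg hs.1 h0.le, by nlinarith [hs.2]⟩, by nlinarith [hs.2]⟩
  have e2 : ∀ {s : ℝ}, s ∈ Set.Ico (0 : ℝ) 1 →
      τ + s * (1 - τ) ∈ Set.Ico (0 : ℝ) 1 ∧ τ ≤ τ + s * (1 - τ) := fun hs =>
    ⟨⟨by nlinarith [hs.1], by nlinarith [hs.2]⟩, by nlinarith [hs.1]⟩
  rintro ⟨k, _ | _⟩ ⟨l, _ | _⟩ s hs t ht h
  · rw [edgePoint_kink_false h0 k hs.2.le, edgePoint_kink_false h0 l ht.2.le] at h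
    obtain ⟨rfl, e⟩ := hg.kinkPoint_eq (e1 hs).1 (e1 ht).1 h
    exact ⟨rfl, mul_right_cancel₀ h0.ne' e⟩
  · rw [edgePoint_kink_false h0 k hs.2.le, edgePoint_kink_true h0 h1 l ht.1] at h
    have := (hg.kinkPoint_eq (e1 hs).1 (e2 ht).1 h).2
    linarith [(e1 hs).2, (e2 ht).2]
  · rw [edgePoint_kink_true h0 h1 k hs.1, edgePoint_kink_false h0 l ht.2.le] at h
    have := (hg.kinkPoint_eq (e2 hs).1 (e1 ht).1 h).2
    linarith [(e2 hs).2, (e1 ht).2]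
  · rw [edgePoint_kink_true h0 h1 k hs.1, edgePoint_kink_true h0 h1 l ht.1] at h
    obtain ⟨rfl, e⟩ := hg.kinkPoint_eq (e2 hs).1 (e2 ht).1 h
    exact ⟨rfl, mul_right_cancel₀ h2.ne' (add_left_cancel e)⟩

lemma segment_eq_image_of_affine {f : ℝ → R3} {lo hi : ℝ} (hle : lo ≤ hi)
    (hf : ∀ s ∈ Set.Icc (0 : ℝ) 1, f (AffineMap.lineMap lo hi s) = AffineMap.lineMap (f lo) (f hi) s) :
    segment ℝ (f lo) (f hi) = f '' Set.Icc lo hi := by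
  rw [← segment_eq_Icc hle, segment_eq_image_lineMap, segment_eq_image_lineMap, Set.image_image]
  exact Set.image_congr fun s hs => (hf s hs).symm

include h0 in
lemma segment_kinkPoint_left (k : Fin n) :
    segment ℝ (kinkPoint P τ a κ k 0) (kinkPoint P τ a κ k τ) =
      kinkPoint P τ a κ k '' Set.Icc 0 τ := by
  refine segment_eq_image_of_affine h0.le fun s hs => ?_
  have : AffineMap.lineMap 0 τ s = s * τ := by simp [AffineMap.lineMap_apply]
  rw [this, ← edgePoint_kink_false h0 k hs.2, edgePoint,
    kinkPerm_false, kinkPolygon_false, kinkPolygon_true]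
  simp [kinkPoint, plHeight_zero h0, plHeight_of_le, h0.ne', -finRotate_apply]

include h0 h1 in
lemma segment_kinkPoint_right (k : Fin n) :
    segment ℝ (kinkPoint P τ a κ k τ) (kinkPoint P τ a κ k 1) =
      kinkPoint P τ a κ k '' Set.Icc τ 1 := by
  refine segment_eq_image_of_affine h1.le fun s hs => ?_
  have : AffineMap.lineMap τ 1 s = τ + s * (1 - τ) := by
    simp [AffineMap.lineMap_apply]; ring
  rw [this, ← edgePoint_kink_true h0 h1 k hs.1, edgePoint,
    kinkPerm_true, kinkPolygon_false, kinkPolygon_true]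
  simp [kinkPoint, plHeight_one h0 h1, plHeight_of_le, h0.ne', -finRotate_apply]

include h0 h1 in
lemma segment_kinkPoint_straight (k : Fin n)
    (hκ : κ k = AffineMap.lineMap (a k) (a (finRotate n k)) τ) :
    segment ℝ (kinkPoint P τ a κ k 0) (kinkPoint P τ a κ k 1) =
      kinkPoint P τ a κ k '' Set.Icc 0 1 := by
  refine segment_eq_image_of_affine zero_le_one fun s hs => ?_
  simp only [kinkPoint, hκ, plHeight_straight h0 h1, lineMap_overPoint]
  simp [AffineMap.lineMap_apply]

include h0 h1 in
/-- A generic broken polygon is a stick knot in which only the genuinely broken edges consist of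
two sticks. -/
lemma KinkGeneric.isStickKnot (hg : KinkGeneric P τ a κ) (cut : Finset (Fin n))
    (hcut : ∀ k ∉ cut, κ k = AffineMap.lineMap (a k) (a (finRotate n k)) τ)
    (hK : IsKnot (polygonSet (kinkPerm n) (kinkPolygon P τ a κ))) :
    IsStickKnot (n + cut.card) (polygonSet (kinkPerm n) (kinkPolygon P τ a κ)) := by
  classical
  -- each stick is the part of an edge between two parameters
  let edge : Fin n ⊕ cut → Fin n := Sum.elim id Subtype.val
  let lo : Fin n ⊕ cut → ℝ := Sum.elim (fun _ => 0) (fun _ => τ)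
  -- The left summand indexes whole unbroken edges and the first sticks of broken ones, the right
  -- summand the second sticks.
  let hi : Fin n ⊕ cut → ℝ := Sum.elim (fun k => if k ∈ cut then τ else 1) (fun _ => 1)
  have hlo : ∀ i, 0 ≤ lo i := by rintro (k | k) <;> simp [lo, h0.le]
  have hhi : ∀ i, hi i ≤ 1 := by
    rintro (k | k)
    · simp only [hi, Sum.elim_inl]; split_ifs <;> linarith
    · simp [hi]
  have hlt : ∀ i, lo i < hi i := by
    rintro (k | k)
    · simp only [hi, lo, Sum.elim_inl]; split_ifs <;> linarith
    · simpa [hi, lo]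
  have hseg : ∀ i, segment ℝ (kinkPoint P τ a κ (edge i) (lo i)) (kinkPoint P τ a κ (edge i) (hi i))
      = kinkPoint P τ a κ (edge i) '' Set.Icc (lo i) (hi i) := by
    rintro (k | k)
    · simp only [edge, hi, lo, Sum.elim_inl, id]
      split_ifs with hk
      · exact segment_kinkPoint_left h0 k
      · exact segment_kinkPoint_straight h0 h1 k (hcut k hk)
    · exact segment_kinkPoint_right h0 h1 k.1
  have hover : ∀ i j, i ≠ j → edge i = edge j → ∀ r ∈ Set.Icc (lo i) (hi i),
      r ∈ Set.Icc (lo j) (hi j) → (r = lo i ∨ r = hi i) ∧ (r = lo j ∨ r = hi j) := by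
    rintro (k | k) (l | l) hij he r hr hr'
    · exact absurd (congrArg Sum.inl he) hij
    · have hk : k ∈ cut := by
        have : k = l.1 := he
        rw [this]; exact l.2
      simp only [hi, lo, Sum.elim_inl, Sum.elim_inr, if_pos hk] at hr hr' ⊢
      have : r = τ := le_antisymm hr.2 hr'.1
      tauto
    · have hk : l ∈ cut := by
        have : k.1 = l := he
        rw [← this]; exact k.2
      simp only [hi, lo, Sum.elim_inl, Sum.elim_inr, if_pos hk] at hr hr' ⊢
      have : r = τ := le_antisymm hr'.2 hr.1
      tauto
    · exact absurd (congrArg Sum.inr (Subtype.ext he)) hij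
  have hcard : Fintype.card (Fin n ⊕ cut) = n + cut.card := by simp
  let φ : Fin (n + cut.card) ≃ Fin n ⊕ cut := (finCongr hcard.symm).trans (Fintype.equivFin _).symm
  refine ⟨hK, fun i => kinkPoint P τ a κ (edge (φ i)) (lo (φ i)),
    fun i => kinkPoint P τ a κ (edge (φ i)) (hi (φ i)), fun i h => ?_, fun i j hij => ?_, ?_⟩
  · have := overPoint_inj.mp h
    exact (hlt (φ i)).ne (AffineMap.lineMap_injective ℝ (hg.1 _) this.1)
  · have hij' : φ i ≠ φ j := fun h => hij (φ.injective h)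
    beta_reduce
    rw [hseg, hseg]
    generalize φ i = i at *
    generalize φ j = j at *
    rintro x ⟨⟨r, hr, rfl⟩, s, hs, hrs⟩
    have hr' : r ∈ Set.Icc (0 : ℝ) 1 := ⟨(hlo i).trans hr.1, hr.2.trans (hhi i)⟩
    have hs' : s ∈ Set.Icc (0 : ℝ) 1 := ⟨(hlo j).trans hs.1, hs.2.trans (hhi j)⟩
    have key : (r = lo i ∨ r = hi i) ∧ (s = lo j ∨ s = hi j) := by
      rcases hg.kinkPoint_eq' h0 h1 hr' hs' hrs.symm with h | h | h
      · obtain ⟨h, rfl⟩ := h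
        exact hover i j hij' h r hr hs
      · exact ⟨Or.inr (le_antisymm hr.2 (h.1 ▸ hhi i)), Or.inl (le_antisymm (h.2 ▸ hlo j) hs.1)⟩
      · exact ⟨Or.inl (le_antisymm (h.1 ▸ hlo i) hr.1), Or.inr (le_antisymm hs.2 (h.2 ▸ hhi j))⟩
    constructor
    · rcases key.1 with h | h <;> simp [h]
    · rw [← hrs]
      rcases key.2 with h | h <;> simp [h]
  · ext x
    rw [mem_polygonSet_kink h0 h1, Set.mem_iUnion]
    constructor
    · rintro ⟨k, r, hr, rfl⟩
      have : ∃ i : Fin n ⊕ cut, edge i = k ∧ r ∈ Set.Icc (lo i) (hi i) := by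
        by_cases hk : k ∈ cut
        · rcases le_total r τ with h | h
          · exact ⟨Sum.inl k, rfl, by simpa [lo, hi, hk] using ⟨hr.1, h⟩⟩
          · exact ⟨Sum.inr ⟨k, hk⟩, rfl, by simpa [lo, hi] using ⟨h, hr.2⟩⟩
        · exact ⟨Sum.inl k, rfl, by simpa [lo, hi, hk] using hr⟩
      obtain ⟨i, rfl, hi'⟩ := this
      refine ⟨φ.symm i, ?_⟩
      beta_reduce
      rw [φ.apply_symm_apply, hseg]
      exact ⟨r, hi', rfl⟩
    · rintro ⟨i, hx⟩
      rw [hseg] at hx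
      obtain ⟨r, hr, rfl⟩ := hx
      exact ⟨_, r, ⟨(hlo _).trans hr.1, hr.2.trans (hhi _)⟩, rfl⟩

lemma continuousOn_kinkPolygon {X : Type*} [TopologicalSpace X] {S : Set X} {P : X → Fin n → R2}
    {a κ : X → Fin n → ℝ} (hP : ∀ k, ContinuousOn (fun x => P x k) S)
    (ha : ∀ k, ContinuousOn (fun x => a x k) S) (hκ : ∀ k, ContinuousOn (fun x => κ x k) S)
    (i : Fin n × Bool) : ContinuousOn (fun x => kinkPolygon (P x) τ (a x) (κ x) i) S := by
  rcases i with ⟨k, _ | _⟩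
  · exact continuous_overPoint.comp_continuousOn (f := fun x => (P x k, a x k)) ((hP k).prodMk (ha k))
  · have : ContinuousOn (fun x => AffineMap.lineMap (P x k) (P x (finRotate n k)) τ) S := by
      simp only [AffineMap.lineMap_apply_module]
      exact ((hP k).const_smul (1 - τ)).add ((hP (finRotate n k)).const_smul τ)
    exact continuous_overPoint.comp_continuousOn
      (f := fun x => (AffineMap.lineMap (P x k) (P x (finRotate n k)) τ, κ x k)) (this.prodMk (hκ k))

end Kink

/-! ### Choice of the heights and of the broken edges. -/

section Heights

/-- The edges of an `(m + 3)`-gon which are broken into two sticks. -/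
def IsCut (m p : ℕ) : Prop := 2 ≤ p ∧ p ≤ m ∧ p % 2 = m % 2

open Classical in
/-- The height at the start of the `p`-th edge if the `p`-th edge has the level `M p`. -/
noncomputable def cutVertexHeight (m : ℕ) (M : ℕ → ℝ) (p : ℕ) : ℝ :=
  if p = 1 then M 1 else if p = m + 3 then M (m + 2) else
    if IsCut m (p - 1) then M p else min (M (p - 1)) (M p)

open Classical in
/-- The height at the parameter `τ` of the `p`-th edge. -/
noncomputable def cutKinkHeight (m : ℕ) (M : ℕ → ℝ) (τ : ℝ) (p : ℕ) : ℝ :=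
  if IsCut m p then M p
  else AffineMap.lineMap (cutVertexHeight m M p) (cutVertexHeight m M (p + 1)) τ

variable {m : ℕ} {M : ℕ → ℝ}

lemma cutVertexHeight_pos (hM : ∀ p, 0 < M p) (p : ℕ) : 0 < cutVertexHeight m M p := by
  unfold cutVertexHeight
  split_ifs
  · exact hM _
  · exact hM _
  · exact hM _
  · exact lt_min (hM _) (hM _)

lemma cutVertexHeight_le {p : ℕ} (hp2 : p ≤ m + 2) :
    cutVertexHeight m M p ≤ M p := by
  unfold cutVertexHeight
  split_ifs with h1 h2 h3
  · rw [h1]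
  · omega
  · exact le_rfl
  · exact min_le_right _ _

/-- A broken edge has to be excluded: its end takes the level of the following edge, possibly a
higher one, which the stick after the kink reaches. -/
lemma cutVertexHeight_succ_le {p : ℕ} (hp1 : 1 ≤ p) (hp : ¬ IsCut m p) :
    cutVertexHeight m M (p + 1) ≤ M p := by
  unfold cutVertexHeight
  rw [if_neg (by omega)]
  split_ifs with h2 h3
  · rw [show p = m + 2 by omega]
  · exact absurd h3 hp
  · exact min_le_left _ _

/-- One end of an unbroken edge has the level of the edge. -/
lemma cutVertexHeight_eq_or {p : ℕ} (hp1 : 1 ≤ p) (hp2 : p ≤ m + 2) (hp : ¬ IsCut m p)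
    (h2 : M 2 ≤ M 1 ∨ M 2 ≤ M 3) :
    cutVertexHeight m M p = M p ∨ cutVertexHeight m M (p + 1) = M p := by
  by_cases h1 : p = 1
  · left; simp [cutVertexHeight, h1]
  by_cases hl : p = m + 2
  · right; simp [cutVertexHeight, hl]
  by_cases hc : IsCut m (p - 1)
  · left; simp [cutVertexHeight, h1, hc, show p ≠ m + 3 by omega]
  -- Broken edges are `m, m - 2, …`, so an unbroken inner edge follows a broken one, with the single
  -- exception of the edge `2` for odd `m`. The hypothesis `h2` serves this exception.
  · have hp2 : p = 2 := by
      unfold IsCut at hp hc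
      omega
    subst hp2
    rcases h2 with h2 | h2
    · left
      simp [cutVertexHeight, hc, h2]
    · right
      simp [cutVertexHeight, show m ≠ 0 by omega, hp, h2]

/-- On the stretch over `[c, 1 - c]` the edge interpolates between the exact level `M p`, attained
at an end or at the kink beyond `1 - c`, and a height in `(0, M p]`. It thus loses at most the
factor `c`, so levels whose ratios exceed `1 / c` keep their order there. -/
lemma plHeight_cut_bounds (hM : ∀ p, 0 < M p) (h2 : M 2 ≤ M 1 ∨ M 2 ≤ M 3) {c : ℝ} (hc : 0 < c)
    (hc1 : c ≤ 1 / 2) {p : ℕ} (hp1 : 1 ≤ p) (hp2 : p ≤ m + 2) {r : ℝ} (hr : r ∈ Set.Icc c (1 - c)) :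
    plHeight (1 - c / 2) (cutVertexHeight m M p) (cutKinkHeight m M (1 - c / 2) p)
      (cutVertexHeight m M (p + 1)) r ∈ Set.Icc (c * M p) (M p) := by
  have ha0 := cutVertexHeight_pos (m := m) hM p
  have ha1 := cutVertexHeight_le (M := M) hp2
  have hMp := hM p
  by_cases hp : IsCut m p
  · rw [cutKinkHeight, if_pos hp, plHeight_of_le _ _ _ (by linarith [hr.2])]
    have hr1 : r / (1 - c / 2) ≤ 1 := (div_le_one (by linarith)).mpr (by linarith [hr.2])
    have hr2 : c ≤ r / (1 - c / 2) := by
      rw [le_div_iff₀ (by linarith)]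
      nlinarith [hr.1]
    generalize r / (1 - c / 2) = s at *
    constructor <;> nlinarith
  · rw [cutKinkHeight, if_neg hp, plHeight_straight (by linarith) (by linarith)]
    have hb0 := cutVertexHeight_pos (m := m) hM (p + 1)
    have hb1 := cutVertexHeight_succ_le (M := M) hp1 hp
    rw [AffineMap.lineMap_apply, smul_eq_mul, vsub_eq_sub, vadd_eq_add]
    have hr1 := hr.1
    have hr2 := hr.2
    rcases cutVertexHeight_eq_or hp1 hp2 hp h2 with h | h <;> rw [h] at * <;>
      constructor <;> nlinarith

/-- Heights for which all but at most `m / 2` edges of an `(m + 3)`-gon are straight and, away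
from the bottom edge `0` and from the ends of the edges, an edge with a larger label is higher. -/
lemma exists_heights (m : ℕ) (label : Equiv.Perm (Fin (m + 3))) {c : ℝ}
    (hc : 0 < c) (hc1 : c ≤ 1 / 2) :
    ∃ (a κ : Fin (m + 3) → ℝ) (cut : Finset (Fin (m + 3))), 2 * cut.card ≤ m ∧
      0 ∉ cut ∧ 1 ∉ cut ∧ Fin.last (m + 2) ∉ cut ∧
      (∀ k ∉ cut, k ≠ 0 →
        κ k = AffineMap.lineMap (a k) (a (finRotate (m + 3) k)) (1 - c / 2)) ∧
      ∀ k l, k ≠ 0 → l ≠ 0 → label k < label l → ∀ r ∈ Set.Icc c (1 - c),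
        ∀ s ∈ Set.Icc c (1 - c),
        plHeight (1 - c / 2) (a k) (κ k) (a (finRotate (m + 3) k)) r <
          plHeight (1 - c / 2) (a l) (κ l) (a (finRotate (m + 3) l)) s := by
  classical
  -- the levels `B ^ e` and the sign `σ`
  obtain ⟨B, hB⟩ := exists_gt (1 / c)
  have hB0 : 0 < B := lt_trans (by positivity) hB
  have hcB : 1 < c * B := by rwa [div_lt_iff₀' hc] at hB
  have hB1 : 1 ≤ B := by nlinarith
  -- The default value is harmless: the only index out of range in the choice of `f` is `3` for `m =
  -- 0`, and then the edge `2` is the last one and needs no condition on levels.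
  set e : ℕ → ℕ := fun p => if h : p < m + 3 then (label ⟨p, h⟩).val else 0 with he
  have hek : ∀ k : Fin (m + 3), e k.val = (label k).val := fun k => by simp [he]
  -- If the edge `2` has a larger label than both neighbours, the exponents are reversed and all
  -- heights negated. The order of the edges is unchanged, but in absolute value the peak at the
  -- edge `2` becomes a valley.
  obtain ⟨σ, f, hf2, hσ⟩ : ∃ (σ : ℝ) (f : ℕ → ℕ), (f 2 ≤ f 1 ∨ f 2 ≤ f 3) ∧
      ((σ = 1 ∧ ∀ k l : Fin (m + 3), label k < label l → f k.val < f l.val) ∨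
        (σ = -1 ∧ ∀ k l : Fin (m + 3), label k < label l → f l.val < f k.val)) := by
    by_cases h : e 2 ≤ e 1 ∨ e 2 ≤ e 3
    · exact ⟨1, e, h, Or.inl ⟨rfl, fun k l hkl => by rw [hek, hek]; exact hkl⟩⟩
    · refine ⟨-1, fun p => m + 3 - e p, by beta_reduce; omega, Or.inr ⟨rfl, fun k l hkl => ?_⟩⟩
      simp only [hek]
      have := (label l).2
      omega
  set M : ℕ → ℝ := fun p => B ^ f p with hMdef
  have hM : ∀ p, 0 < M p := fun p => by positivity
  have h2 : M 2 ≤ M 1 ∨ M 2 ≤ M 3 :=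
    hf2.imp (fun h => pow_le_pow_right₀ hB1 h) (fun h => pow_le_pow_right₀ hB1 h)
  have hlt : ∀ p q, f p < f q → M p < c * M q := by
    intro p q hpq
    have h1 : B * M p ≤ M q := by
      rw [hMdef, ← pow_succ']
      exact pow_le_pow_right₀ hB1 hpq
    have := hM p
    calc M p = 1 * M p := (one_mul _).symm
      _ < c * B * M p := by nlinarith
      _ = c * (B * M p) := by ring
      _ ≤ _ := mul_le_mul_of_nonneg_left h1 hc.le
  set A : ℕ → ℝ := fun p => σ * cutVertexHeight m M p with hA
  -- The vertex `0` is the end of the last edge, hence the index `m + 3`.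
  set a : Fin (m + 3) → ℝ := fun k => if k = 0 then A (m + 3) else A k.val with ha
  have hak : ∀ k, k ≠ 0 → a k = A k.val := fun k hk => if_neg hk
  have hak' : ∀ k, k ≠ 0 → a (finRotate (m + 3) k) = A (k.val + 1) := by
    intro k hk
    rcases Fin.eq_castSucc_or_eq_last k with ⟨k, rfl⟩ | rfl
    · rw [finRotate_apply, Fin.coeSucc_eq_succ, hak _ (Fin.succ_ne_zero _)]
      simp
    · simp [ha]
  have hval : ∀ k : Fin (m + 3), k ≠ 0 → 1 ≤ k.val := fun k hk =>
    Nat.one_le_iff_ne_zero.mpr fun h => hk (Fin.ext h)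
  refine ⟨a, fun k => σ * cutKinkHeight m M (1 - c / 2) k.val,
    Finset.univ.filter fun k => IsCut m k.val, ?_, ?_, ?_, ?_, ?_, ?_⟩
  · have : (Finset.univ.filter fun k : Fin (m + 3) => IsCut m k.val).card ≤
        (Finset.Icc 1 (m / 2)).card := by
      -- All broken edges have indices of the parity of `m`, so halving is injective on them.
      refine Finset.card_le_card_of_injOn (fun k => k.val / 2) ?_ ?_
      · intro k hk
        have hk : IsCut m k.val := by simpa using hk
        obtain ⟨h1, h2, h3⟩ := hk
        simp only [Finset.coe_Icc, Set.mem_Icc]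
        omega
      · intro k hk l hl hkl
        have hk : IsCut m k.val := by simpa using hk
        have hl : IsCut m l.val := by simpa using hl
        obtain ⟨h1, h2, h3⟩ := hk
        obtain ⟨h1', h2', h3'⟩ := hl
        apply Fin.ext
        have : k.val / 2 = l.val / 2 := hkl
        omega
    rw [Nat.card_Icc] at this
    omega
  · rw [Finset.mem_filter]
    rintro ⟨-, h, -⟩
    simp at h
  · rw [Finset.mem_filter]
    rintro ⟨-, h, -⟩
    simp at h
  · rw [Finset.mem_filter]
    rintro ⟨-, -, h, -⟩
    simp at h
  · intro k hk hk0
    have hk : ¬ IsCut m k.val := by simpa using hk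
    beta_reduce
    rw [hak k hk0, hak' k hk0, cutKinkHeight, if_neg hk]
    simp only [hA, AffineMap.lineMap_apply, smul_eq_mul, vsub_eq_sub, vadd_eq_add]
    ring
  · intro k l hk hl hkl r hr s hs
    have hscale : ∀ x y z t : ℝ, plHeight (1 - c / 2) (σ * x) (σ * y) (σ * z) t =
        σ * plHeight (1 - c / 2) x y z t := by
      intro x y z t
      simp only [plHeight, AffineMap.lineMap_apply, smul_eq_mul, vsub_eq_sub, vadd_eq_add]
      split_ifs <;> ring
    rw [hak k hk, hak l hl, hak' k hk, hak' l hl, hscale, hscale]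
    have b1 := plHeight_cut_bounds (m := m) hM h2 hc hc1 (hval k hk) (by omega) hr
    have b2 := plHeight_cut_bounds (m := m) hM h2 hc hc1 (hval l hl) (by omega) hs
    rcases hσ with ⟨rfl, hσ⟩ | ⟨rfl, hσ⟩
    · have := hlt _ _ (hσ k l hkl)
      linarith [b1.2, b2.1]
    · have := hlt _ _ (hσ k l hkl)
      linarith [b1.1, b2.2]

end Heights

/-! ### Rays leaving the disk. -/

section Rays

/-- Since `‖j‖ ≤ 1 = ‖w‖`, the vector `w - j` has a positive inner product with `w`; hence a chord
continued beyond its end never returns to the disk. -/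
lemma norm_add_smul_outward {w j : R2} (hw : ‖w‖ = 1) (hj : ‖j‖ ≤ 1) (hwj : w ≠ j) {t : ℝ}
    (ht : 0 < t) : 1 < ‖w + t • (w - j)‖ := by
  have h0 : 0 < ‖w - j‖ := norm_pos_iff.mpr (sub_ne_zero.mpr hwj)
  have h1 : ‖w + t • (w - j)‖ ^ 2 = 1 + 2 * t * inner ℝ w (w - j) + t ^ 2 * ‖w - j‖ ^ 2 := by
    rw [norm_add_sq_real, hw, inner_smul_right, norm_smul, mul_pow, Real.norm_eq_abs, sq_abs]
    ring
  have h2 : ‖j‖ ^ 2 = 1 - 2 * inner ℝ w (w - j) + ‖w - j‖ ^ 2 := by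
    have := norm_sub_sq_real w (w - j)
    rwa [sub_sub_cancel, hw, one_pow] at this
  have h3 : ‖j‖ ^ 2 ≤ 1 := pow_le_one₀ (norm_nonneg _) hj
  have h4 : 0 < inner ℝ w (w - j) := by nlinarith
  have h5 : 0 < t ^ 2 * ‖w - j‖ ^ 2 := by positivity
  have h6 : 0 < t * inner ℝ w (w - j) := by positivity
  nlinarith [norm_nonneg (w + t • (w - j))]

/-- Two rays that leave the unit disk in directions which are not opposite can be cut off so that
they stay disjoint and the segment between their end points avoids the disk. -/
lemma exists_outer_segment {w w' j j' : R2} (hw : ‖w‖ = 1) (hw' : ‖w'‖ = 1) (hj : ‖j‖ ≤ 1)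
    (hj' : ‖j'‖ ≤ 1) (hwj : w ≠ j) (hwj' : w' ≠ j') (hww : w ≠ w')
    (hanti : ∀ r : ℝ, 0 < r → w' - j' ≠ -(r • (w - j))) :
    ∃ (ν : R2) (c ρ ρ' : ℝ), ‖ν‖ < c ∧ 0 < ρ ∧ 0 < ρ' ∧ inner ℝ ν (w + ρ • (w - j)) = c ∧
      inner ℝ ν (w' + ρ' • (w' - j')) = c ∧ 0 < inner ℝ ν (w - j) ∧ 0 < inner ℝ ν (w' - j') ∧
      ∀ s ∈ Set.Icc 0 ρ, ∀ t ∈ Set.Icc 0 ρ', w + s • (w - j) ≠ w' + t • (w' - j') := by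
  have out := fun {t : ℝ} (ht : 0 < t) => norm_add_smul_outward hw hj hwj ht
  have out' := fun {t : ℝ} (ht : 0 < t) => norm_add_smul_outward hw' hj' hwj' ht
  set u := w - j
  set u' := w' - j'
  have hu : 0 < ‖u‖ := norm_pos_iff.mpr (sub_ne_zero.mpr hwj)
  have hu' : 0 < ‖u'‖ := norm_pos_iff.mpr (sub_ne_zero.mpr hwj')
  have hle : ∀ (ν x : R2), ‖x‖ = 1 → inner ℝ ν x ≤ ‖ν‖ := fun ν x hx => by
    simpa [hx] using real_inner_le_norm ν x
  have finish : ∀ (ν x v : R2) (c : ℝ), ‖x‖ = 1 → ‖ν‖ < c → 0 < inner ℝ ν v →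
      0 < (c - inner ℝ ν x) / inner ℝ ν v ∧
        inner ℝ ν (x + ((c - inner ℝ ν x) / inner ℝ ν v) • v) = c := by
    intro ν x v c hx hc hv
    refine ⟨div_pos (by linarith [hle ν x hx]) hv, ?_⟩
    rw [inner_add_right, inner_smul_right, div_mul_cancel₀ _ hv.ne']
    ring
  by_cases hmeet : ∃ s t : ℝ, 0 ≤ s ∧ 0 ≤ t ∧ w + s • u = w' + t • u'
  · obtain ⟨s, t, hs, ht, hst⟩ := hmeet
    have hs0 : 0 < s := by
      rcases hs.eq_or_lt with rfl | h
      · rw [zero_smul, add_zero] at hst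
        rcases ht.eq_or_lt with rfl | h'
        · rw [zero_smul, add_zero] at hst
          exact absurd hst hww
        · have := out' h'
          rw [← hst, hw] at this
          exact absurd this (lt_irrefl _)
      · exact h
    have ht0 : 0 < t := by
      rcases ht.eq_or_lt with rfl | h
      · rw [zero_smul, add_zero] at hst
        have := out hs0
        rw [hst, hw'] at this
        exact absurd this (lt_irrefl _)
      · exact h
    have hQ := out hs0
    set Q := w + s • u with hQdef
    have hQQ : inner ℝ Q Q = ‖Q‖ ^ 2 := real_inner_self_eq_norm_sq Q
    -- The line where `inner ℝ Q x = c` misses the disk by the first inequality and cuts off both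
    -- rays before their meeting point `Q` by the second.
    obtain ⟨c, hc1, hc2⟩ : ∃ c, ‖Q‖ < c ∧ c < ‖Q‖ ^ 2 := exists_between (by nlinarith)
    have e1 : inner ℝ Q w + s * inner ℝ Q u = ‖Q‖ ^ 2 := by
      rw [← inner_smul_right, ← inner_add_right, ← hQdef, hQQ]
    have e2 : inner ℝ Q w' + t * inner ℝ Q u' = ‖Q‖ ^ 2 := by
      rw [← inner_smul_right, ← inner_add_right, ← hst, hQQ]
    have l1 := hle Q w hw
    have l2 := hle Q w' hw'
    have p1 : 0 < inner ℝ Q u := by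
      by_contra! h
      nlinarith
    have p2 : 0 < inner ℝ Q u' := by
      by_contra! h
      nlinarith
    refine ⟨Q, c, _, _, hc1, (finish Q w u c hw hc1 p1).1, (finish Q w' u' c hw' hc1 p2).1,
      (finish Q w u c hw hc1 p1).2, (finish Q w' u' c hw' hc1 p2).2, p1, p2, ?_⟩
    -- A second common point would make the rays parallel with the same direction, so that one
    -- starts on the other; but both start on the circle and leave the disk at once.
    intro a ha b hb hab
    have ha' : a < s := lt_of_le_of_lt ha.2 (by rw [div_lt_iff₀ p1]; linarith)
    have hb' : b < t := lt_of_le_of_lt hb.2 (by rw [div_lt_iff₀ p2]; linarith)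
    have h1 : (s - a) • u = (t - b) • u' := by
      have : (s - a) • u = Q - (w + a • u) := by rw [hQdef]; module
      rw [this, hab, hst]; module
    set γ := (s - a) / (t - b) with hγ
    have hγ0 : 0 < γ := div_pos (by linarith) (by linarith)
    have h2 : u' = γ • u := by
      rw [hγ, div_eq_inv_mul, mul_smul, h1, smul_smul, inv_mul_cancel₀ (by linarith), one_smul]
    have h3 : w + (a - b * γ) • u = w' := by
      rw [h2] at hab
      rw [sub_smul, ← add_sub_assoc, hab, mul_smul]; abel
    rcases lt_trichotomy (a - b * γ) 0 with h | h | h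
    · have := out' (t := (b * γ - a) / γ) (div_pos (by linarith) hγ0)
      have e : w' + ((b * γ - a) / γ) • u' = w := by
        rw [h2, smul_smul, div_mul_cancel₀ _ hγ0.ne', ← h3]; module
      rw [e, hw] at this
      exact lt_irrefl _ this
    · rw [h, zero_smul, add_zero] at h3
      exact hww h3
    · have := out h
      rw [h3, hw'] at this
      exact lt_irrefl _ this
  -- Disjoint rays need no early cut: along the bisector of their directions, which are not
  -- opposite, both rays advance, so they reach any line orthogonal to it beyond the disk.
  · set ν := ‖u'‖ • u + ‖u‖ • u' with hν
    have hlow : -(‖u‖ * ‖u'‖) < inner ℝ u u' := by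
      refine lt_of_le_of_ne (neg_le_of_abs_le (abs_real_inner_le_norm u u')) fun h => ?_
      have h1 : ‖ν‖ ^ 2 = 0 := by
        rw [hν, norm_add_sq_real, norm_smul, norm_smul, inner_smul_left, inner_smul_right, ← h]
        simp only [norm_norm, conj_trivial]
        ring
      have h2 : ν = 0 := norm_eq_zero.mp (pow_eq_zero_iff (two_ne_zero) |>.mp h1)
      refine hanti (‖u'‖ / ‖u‖) (by positivity) ?_
      have h3 : ‖u‖ • u' = -(‖u'‖ • u) := by
        rw [eq_neg_iff_add_eq_zero, add_comm]; exact h2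
      rw [div_eq_inv_mul, mul_smul, ← smul_neg, ← h3, smul_smul, inv_mul_cancel₀ hu.ne', one_smul]
    have p1 : 0 < inner ℝ ν u := by
      rw [hν, inner_add_left, inner_smul_left, inner_smul_left, real_inner_self_eq_norm_sq,
        real_inner_comm]
      simp only [conj_trivial]
      nlinarith
    have p2 : 0 < inner ℝ ν u' := by
      rw [hν, inner_add_left, inner_smul_left, inner_smul_left, real_inner_self_eq_norm_sq]
      simp only [conj_trivial]
      nlinarith
    have hc1 : ‖ν‖ < ‖ν‖ + 1 := by linarith
    refine ⟨ν, ‖ν‖ + 1, _, _, hc1, (finish ν w u _ hw hc1 p1).1, (finish ν w' u' _ hw' hc1 p2).1,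
      (finish ν w u _ hw hc1 p1).2, (finish ν w' u' _ hw' hc1 p2).2, p1, p2, ?_⟩
    exact fun a ha b hb hab => hmeet ⟨a, b, ha.1, hb.1, hab⟩

end Rays

/-! ### Uniform control of crossings and a perturbation of one vertex. -/

lemma Finite.exists_pos_le {ι : Type*} [Finite ι] (f : ι → ℝ) (hf : ∀ i, 0 < f i) :
    ∃ d > 0, ∀ i, d ≤ f i := by
  rcases isEmpty_or_nonempty ι with h | h
  · exact ⟨1, one_pos, fun i => h.elim i⟩
  · obtain ⟨i, hi⟩ := Finite.exists_min f
    exact ⟨f i, hf i, hi⟩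

namespace CirclePolygon

section

variable {n : ℕ} (D : CirclePolygon n)

lemma chordPoint_eq_combination (k : Fin n) (t : ℝ) :
    D.chordPoint k t = (1 - t) • D.vertex k + t • D.vertex (finRotate n k) := by
  rw [chordPoint, AffineMap.lineMap_apply_module]

lemma norm_chordPoint_le {k : Fin n} {t : ℝ} (ht : t ∈ Set.Icc (0 : ℝ) 1) :
    ‖D.chordPoint k t‖ ≤ 1 := by
  by_cases h : t = 0 ∨ t = 1
  · exact ((D.norm_chordPoint_eq_one_iff ht).mpr h).le
  · push Not at h
    exact (D.norm_chordPoint_lt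
      ⟨lt_of_le_of_ne ht.1 h.1.symm, lt_of_le_of_ne ht.2 h.2⟩).le

lemma continuous_chordPoint (k : Fin n) : Continuous (D.chordPoint k) := by
  unfold chordPoint
  exact AffineMap.lineMap_continuous

lemma vertex_ne_chordPoint {i k : Fin n} (hik : i ≠ k) (hik' : i ≠ finRotate n k) {t : ℝ}
    (ht : t ∈ Set.Icc (0 : ℝ) 1) : D.vertex i ≠ D.chordPoint k t := by
  intro h
  have h1 := (D.norm_chordPoint_eq_one_iff ht).mp (h ▸ D.norm_vertex i)
  rcases h1 with rfl | rfl
  · rw [chordPoint_zero] at h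
    exact hik (D.vertex_injective h)
  · rw [chordPoint_one] at h
    exact hik' (D.vertex_injective h)

/-- Vertices keep a distance from the other chords. -/
lemma exists_le_dist : ∃ d > 0, ∀ i k, i ≠ k → i ≠ finRotate n k → ∀ t ∈ Set.Icc (0 : ℝ) 1,
    d ≤ ‖D.vertex i - D.chordPoint k t‖ := by
  have h : ∀ p : Fin n × Fin n, ∃ d > 0, p.1 ≠ p.2 → p.1 ≠ finRotate n p.2 →
      ∀ t ∈ Set.Icc (0 : ℝ) 1, d ≤ ‖D.vertex p.1 - D.chordPoint p.2 t‖ := by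
    rintro ⟨i, k⟩
    by_cases hik : i ≠ k ∧ i ≠ finRotate n k
    · obtain ⟨t₀, ht₀, hmin⟩ := isCompact_Icc.exists_isMinOn (Set.nonempty_Icc.mpr zero_le_one)
        (f := fun t : ℝ => ‖D.vertex i - D.chordPoint k t‖) (s := Set.Icc 0 1)
        (continuous_const.sub (D.continuous_chordPoint k)).norm.continuousOn
      refine ⟨_, norm_pos_iff.mpr (sub_ne_zero.mpr (D.vertex_ne_chordPoint hik.1 hik.2 ht₀)),
        fun _ _ t ht => hmin ht⟩
    · exact ⟨1, one_pos, fun h1 h2 => absurd ⟨h1, h2⟩ hik⟩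
  choose f hf hf' using h
  obtain ⟨d, hd, hle⟩ := Finite.exists_pos_le f hf
  exact ⟨d, hd, fun i k h1 h2 t ht => (hle (i, k)).trans (hf' (i, k) h1 h2 t ht)⟩

/-- In all nearby polygons the crossings keep a distance from the ends of the chords. -/
lemma exists_crossing_bound : ∃ c > 0, c ≤ 1 / 2 ∧ ∀ D' : CirclePolygon n,
    (∀ k, ‖D'.vertex k - D.vertex k‖ ≤ c) → ∀ k l, k ≠ l → ∀ s ∈ Set.Ioo (0 : ℝ) 1,
      ∀ t ∈ Set.Ioo (0 : ℝ) 1, D'.chordPoint k s = D'.chordPoint l t → s ∈ Set.Icc c (1 - c) := by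
  obtain ⟨d, hd, hdist⟩ := D.exists_le_dist
  -- Moving vertices by at most `c` changes a distance between vertex and chord by at most `2 * c`,
  -- leaving `d - 2 * c ≥ 2 * c`. Chords have length at most `2`, so a crossing has parameter
  -- distance at least `c` from the ends.
  refine ⟨min (d / 4) (1 / 2), by positivity, min_le_right _ _, fun D' hD' k l hkl s hs t ht h => ?_⟩
  set c := min (d / 4) (1 / 2) with hc
  have hcd : c ≤ d / 4 := min_le_left _ _
  have hkl1 : k ≠ finRotate n l := by
    rintro rfl
    exact D'.chordPoint_ne_next ht hs h.symm
  have hkl2 : finRotate n k ≠ l := by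
    rintro rfl
    exact D'.chordPoint_ne_next hs ht h
  have hdist' : ∀ i, i ≠ l → i ≠ finRotate n l → 2 * c ≤ ‖D'.vertex i - D'.chordPoint l t‖ := by
    intro i h1 h2
    have e1 := hdist i l h1 h2 t (Set.Ioo_subset_Icc_self ht)
    have e2 : ‖D'.chordPoint l t - D.chordPoint l t‖ ≤ c := by
      have : D'.chordPoint l t - D.chordPoint l t = (1 - t) • (D'.vertex l - D.vertex l) +
          t • (D'.vertex (finRotate n l) - D.vertex (finRotate n l)) := by
        rw [chordPoint_eq_combination, chordPoint_eq_combination]; module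
      rw [this]
      refine (norm_add_le _ _).trans ?_
      rw [norm_smul, norm_smul, Real.norm_eq_abs, Real.norm_eq_abs, abs_of_pos ht.1,
        abs_of_pos (by linarith [ht.2])]
      nlinarith [hD' l, hD' (finRotate n l), ht.1, ht.2]
    have e3 : D.vertex i - D.chordPoint l t = (D'.vertex i - D'.chordPoint l t) -
        (D'.vertex i - D.vertex i) + (D'.chordPoint l t - D.chordPoint l t) := by abel
    rw [e3] at e1
    have := norm_add_le ((D'.vertex i - D'.chordPoint l t) - (D'.vertex i - D.vertex i))
      (D'.chordPoint l t - D.chordPoint l t)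
    have := norm_sub_le (D'.vertex i - D'.chordPoint l t) (D'.vertex i - D.vertex i)
    linarith [hD' i]
  have hlen : ‖D'.vertex k - D'.vertex (finRotate n k)‖ ≤ 2 := by
    refine (norm_sub_le _ _).trans ?_
    rw [norm_vertex, norm_vertex]
    norm_num
  constructor
  · have h1 := hdist' k hkl hkl1
    have : D'.vertex k - D'.chordPoint l t = s • (D'.vertex k - D'.vertex (finRotate n k)) := by
      rw [← h, chordPoint_eq_combination]; module
    rw [this, norm_smul, Real.norm_eq_abs, abs_of_pos hs.1] at h1
    nlinarith [hs.1]
  · have h1 := hdist' (finRotate n k) hkl2 fun h => hkl ((finRotate n).injective h)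
    have : D'.vertex (finRotate n k) - D'.chordPoint l t =
        -((1 - s) • (D'.vertex k - D'.vertex (finRotate n k))) := by
      rw [← h, chordPoint_eq_combination]; module
    rw [this, norm_neg, norm_smul, Real.norm_eq_abs, abs_of_pos (by linarith [hs.2])] at h1
    nlinarith [hs.2]

end

lemma finRotate_zero (m : ℕ) : finRotate (m + 3) 0 = 1 := by simp

lemma finRotate_one (m : ℕ) : finRotate (m + 3) 1 = 2 := by
  rw [finRotate_apply]; rfl

/-- Arbitrarily close to a polygon there is one such that the edges next to the edge `0` do not
leave it in opposite directions. -/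
lemma exists_close_not_antiparallel {m : ℕ} (D : CirclePolygon (m + 3)) {δ : ℝ} (hδ : 0 < δ) :
    ∃ D' : CirclePolygon (m + 3), (∀ k, ‖D'.vertex k - D.vertex k‖ ≤ δ) ∧ ∀ r : ℝ, 0 < r →
      D'.vertex 1 - D'.vertex 2 ≠ -(r • (D'.vertex 0 - D'.vertex (Fin.last (m + 2)))) := by
  by_cases hanti : ∃ r : ℝ, 0 < r ∧
      D.vertex 1 - D.vertex 2 = -(r • (D.vertex 0 - D.vertex (Fin.last (m + 2))))
  swap
  · push Not at hanti
    exact ⟨D, fun k => by simpa using hδ.le, hanti⟩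
  obtain ⟨r, hr, hanti⟩ := hanti
  set e := Fin.last (m + 2) with he
  have he0 : e ≠ 0 := Fin.last_pos.ne'
  have he1 : e ≠ 1 := by
    intro h
    have := congrArg Fin.val h
    simp [he] at this
  -- For a triangle the last vertex is the vertex `2`; then opposite directions would put three
  -- distinct points of the circle on a line.
  have he2 : e ≠ 2 := by
    intro h
    rw [← h] at hanti
    have := eq_of_sub_eq_smul_sub (D.norm_vertex e) (D.norm_vertex 1) (D.norm_vertex 0)
      (neg_ne_zero.mpr hr.ne') (fun h => he0 (D.vertex_injective h).symm) (by rw [neg_smul, hanti])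
    exact absurd (D.vertex_injective this) (by simp)
  obtain ⟨d, hd, hdle⟩ := Finite.exists_pos_le
    (fun k : {k // k ≠ e} => ‖D.vertex k - D.vertex e‖)
    (fun k => norm_pos_iff.mpr (sub_ne_zero.mpr fun h => k.2 (D.vertex_injective h)))
  -- The circle has no isolated points, so the last vertex can be moved slightly along it. The line
  -- through the vertex `0` in the forbidden direction meets the circle in only one further point,
  -- the old position.
  have hacc : ∃ y : R2, y ≠ D.vertex e ∧ ‖y‖ = 1 ∧ ‖y - D.vertex e‖ < min d δ := by
    have hconn : IsPreconnected (Metric.sphere (0 : R2) 1) :=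
      isPreconnected_sphere (by rw [← Module.finrank_eq_rank]; simp) 0 1
    have hnt : (Metric.sphere (0 : R2) 1).Nontrivial :=
      ⟨D.vertex 0, by simp [D.norm_vertex], D.vertex e, by simp [D.norm_vertex],
        fun h => he0 (D.vertex_injective h).symm⟩
    have := (hconn.preperfect_of_nontrivial hnt) (D.vertex e) (by simp [D.norm_vertex])
    have h2 := (accPt_iff_frequently.mp this).and_eventually
      (Metric.ball_mem_nhds (D.vertex e) (lt_min hd hδ))
    obtain ⟨y, hy1, hy2⟩ := h2.exists
    exact ⟨y, hy1.1, by simpa using hy1.2, by rw [← dist_eq_norm]; exact hy2⟩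
  obtain ⟨y, hy, hy1, hyd⟩ := hacc
  refine ⟨⟨by omega, Function.update D.vertex e y, fun k => ?_, ?_⟩, fun k => ?_, ?_⟩
  · by_cases hk : k = e
    · subst hk; simpa using hy1
    · simpa [hk] using D.norm_vertex k
  · have hne : ∀ k, k ≠ e → D.vertex k ≠ y := by
      intro k hk h
      have := hdle ⟨k, hk⟩
      simp only [h] at this
      linarith [min_le_left d δ]
    intro k l hkl
    by_cases hk : k = e <;> by_cases hl : l = e
    · rw [hk, hl]
    · rw [hk] at hkl
      simp only [Function.update_self, Function.update_of_ne hl] at hkl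
      exact absurd hkl.symm (hne l hl)
    · rw [hl] at hkl
      simp only [Function.update_self, Function.update_of_ne hk] at hkl
      exact absurd hkl (hne k hk)
    · simp only [Function.update_of_ne hl, Function.update_of_ne hk] at hkl
      exact D.vertex_injective hkl
  · by_cases hk : k = e
    · subst hk
      simpa using hyd.le.trans (min_le_right _ _)
    · simpa [hk] using hδ.le
  · intro q hq h
    simp only [Function.update_self, Function.update_of_ne he0.symm,
      Function.update_of_ne he1.symm, Function.update_of_ne he2.symm] at h
    rw [h, neg_inj] at hanti
    refine hy (eq_of_sub_eq_smul_sub (r := r / q) (D.norm_vertex 0) hy1 (D.norm_vertex e)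
      (by positivity) (fun h => he0 (D.vertex_injective h)) ?_)
    have h3 : D.vertex 0 - y = q⁻¹ • (r • (D.vertex 0 - D.vertex e)) := by
      rw [← hanti, smul_smul, inv_mul_cancel₀ hq.ne', one_smul]
    rw [← neg_sub, h3, div_eq_inv_mul, mul_smul]
    module

end CirclePolygon

/-! ### Prolonging the neighbours of the bottom edge. -/

/-- A polygon in space over a polygon inscribed in the unit circle, together with the data along
which the two edges next to the edge `0` are going to be extended out of the disk. -/
structure SlidingPolygon (m : ℕ) extends CirclePolygon (m + 3) where
  a : Fin (m + 3) → ℝ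
  κ : Fin (m + 3) → ℝ
  c : ℝ
  c_pos : 0 < c
  c_le : c ≤ 1 / 2
  cross : ∀ k l, k ≠ l → ∀ s ∈ Set.Ioo (0 : ℝ) 1, ∀ t ∈ Set.Ioo (0 : ℝ) 1,
    toCirclePolygon.chordPoint k s = toCirclePolygon.chordPoint l t → s ∈ Set.Icc c (1 - c)
  order : ∀ k l, k ≠ 0 → l ≠ 0 → k ≠ l → ∀ s ∈ Set.Icc c (1 - c), ∀ t ∈ Set.Icc c (1 - c),
    plHeight (1 - c / 2) (a k) (κ k) (a (finRotate (m + 3) k)) s ≠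
      plHeight (1 - c / 2) (a l) (κ l) (a (finRotate (m + 3) l)) t
  -- Both neighbours of the edge `0` are straight, so that they can be prolonged in space along
  -- their own lines.
  straight_one : κ 1 = AffineMap.lineMap (a 1) (a 2) (1 - c / 2)
  straight_last : κ (Fin.last (m + 2)) =
    AffineMap.lineMap (a (Fin.last (m + 2))) (a 0) (1 - c / 2)
  -- The line where `inner ℝ ν x = C` passes outside the disk and contains both end points of the
  -- complete extension.
  ν : R2
  C : ℝ
  ρ : ℝ
  ρ' : ℝ
  norm_ν_lt : ‖ν‖ < C
  ρ_pos : 0 < ρ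
  ρ'_pos : 0 < ρ'
  inner_end : inner ℝ ν (vertex 0 + ρ • (vertex 0 - vertex (Fin.last (m + 2)))) = C
  inner_end' : inner ℝ ν (vertex 1 + ρ' • (vertex 1 - vertex 2)) = C
  inner_pos : 0 < inner ℝ ν (vertex 0 - vertex (Fin.last (m + 2)))
  inner_pos' : 0 < inner ℝ ν (vertex 1 - vertex 2)
  rays : ∀ s ∈ Set.Icc 0 ρ, ∀ t ∈ Set.Icc 0 ρ', vertex 0 + s • (vertex 0 - vertex (Fin.last (m + 2)))
    ≠ vertex 1 + t • (vertex 1 - vertex 2)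

namespace SlidingPolygon

variable {m : ℕ} (Q : SlidingPolygon m)

/-- The parameter of the kinks. -/
noncomputable def τ : ℝ := 1 - Q.c / 2

lemma τ_pos : 0 < Q.τ := by have := Q.c_le; unfold τ; linarith

lemma τ_lt : Q.τ < 1 := by have := Q.c_pos; unfold τ; linarith

/-- The vertices after the extension by the fraction `r`. -/
noncomputable def pos (r : ℝ) (k : Fin (m + 3)) : R2 :=
  if k = 0 then Q.vertex 0 + (r * Q.ρ) • (Q.vertex 0 - Q.vertex (Fin.last (m + 2)))
  else if k = 1 then Q.vertex 1 + (r * Q.ρ') • (Q.vertex 1 - Q.vertex 2) else Q.vertex k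

/-- The heights of the vertices after the extension by the fraction `r`. -/
noncomputable def ht (r : ℝ) (k : Fin (m + 3)) : ℝ :=
  if k = 0 then Q.a 0 + (r * Q.ρ) * (Q.a 0 - Q.a (Fin.last (m + 2)))
  else if k = 1 then Q.a 1 + (r * Q.ρ') * (Q.a 1 - Q.a 2) else Q.a k

/-- The heights of the kinks, where `q` is the height of the kink of the edge `0`. -/
noncomputable def kink (r q : ℝ) (k : Fin (m + 3)) : ℝ :=
  if k = 0 then q
  else if k = 1 ∨ k = Fin.last (m + 2) then
    AffineMap.lineMap (Q.ht r k) (Q.ht r (finRotate (m + 3) k)) Q.τ else Q.κ k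

/-- The points of the edges of the planar polygon. -/
noncomputable def pt (r : ℝ) (k : Fin (m + 3)) (s : ℝ) : R2 :=
  AffineMap.lineMap (Q.pos r k) (Q.pos r (finRotate (m + 3) k)) s

/-- The heights above the edges. -/
noncomputable def height (r q : ℝ) (k : Fin (m + 3)) (s : ℝ) : ℝ :=
  plHeight Q.τ (Q.ht r k) (Q.kink r q k) (Q.ht r (finRotate (m + 3) k)) s

lemma one_ne : (1 : Fin (m + 3)) ≠ 0 := by simp

lemma two_ne : (2 : Fin (m + 3)) ≠ 0 := by
  intro h; have := congrArg Fin.val h; simp [Nat.mod_eq_of_lt (show 2 < m + 3 by omega)] at this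

lemma two_ne_one : (2 : Fin (m + 3)) ≠ 1 := by
  intro h; have := congrArg Fin.val h; simp [Nat.mod_eq_of_lt (show 2 < m + 3 by omega)] at this

lemma last_ne : Fin.last (m + 2) ≠ 0 := Fin.last_pos.ne'

lemma last_ne_one : Fin.last (m + 2) ≠ 1 := by
  intro h; have := congrArg Fin.val h; simp at this

lemma next_last : finRotate (m + 3) (Fin.last (m + 2)) = 0 := by simp

lemma next_ne_zero {k : Fin (m + 3)} (h : k ≠ Fin.last (m + 2)) : finRotate (m + 3) k ≠ 0 :=
  fun h' => h ((finRotate (m + 3)).injective (h'.trans next_last.symm))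

lemma next_ne_one {k : Fin (m + 3)} (h : k ≠ 0) : finRotate (m + 3) k ≠ 1 :=
  fun h' => h ((finRotate (m + 3)).injective (h'.trans (CirclePolygon.finRotate_zero m).symm))

lemma pos_zero (r : ℝ) : Q.pos r 0 =
    Q.vertex 0 + (r * Q.ρ) • (Q.vertex 0 - Q.vertex (Fin.last (m + 2))) := if_pos rfl

lemma pos_one (r : ℝ) : Q.pos r 1 = Q.vertex 1 + (r * Q.ρ') • (Q.vertex 1 - Q.vertex 2) := by
  rw [pos, if_neg one_ne, if_pos rfl]

lemma pos_of_ne (r : ℝ) {k : Fin (m + 3)} (h0 : k ≠ 0) (h1 : k ≠ 1) : Q.pos r k = Q.vertex k := by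
  rw [pos, if_neg h0, if_neg h1]

lemma ht_zero (r : ℝ) : Q.ht r 0 = Q.a 0 + (r * Q.ρ) * (Q.a 0 - Q.a (Fin.last (m + 2))) :=
  if_pos rfl

lemma ht_one (r : ℝ) : Q.ht r 1 = Q.a 1 + (r * Q.ρ') * (Q.a 1 - Q.a 2) := by
  rw [ht, if_neg one_ne, if_pos rfl]

lemma ht_of_ne (r : ℝ) {k : Fin (m + 3)} (h0 : k ≠ 0) (h1 : k ≠ 1) : Q.ht r k = Q.a k := by
  rw [ht, if_neg h0, if_neg h1]

lemma height_last (r q s : ℝ) : Q.height r q (Fin.last (m + 2)) s =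
    AffineMap.lineMap (Q.ht r (Fin.last (m + 2))) (Q.ht r 0) s := by
  rw [height, kink, if_neg last_ne, if_pos (Or.inr rfl), plHeight_straight Q.τ_pos Q.τ_lt, next_last]

lemma height_one (r q s : ℝ) : Q.height r q 1 s = AffineMap.lineMap (Q.ht r 1) (Q.ht r 2) s := by
  rw [height, kink, if_neg one_ne, if_pos (Or.inl rfl), plHeight_straight Q.τ_pos Q.τ_lt,
    CirclePolygon.finRotate_one]

lemma pt_last (r s : ℝ) : Q.pt r (Fin.last (m + 2)) s = Q.vertex (Fin.last (m + 2)) +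
    (s * (1 + r * Q.ρ)) • (Q.vertex 0 - Q.vertex (Fin.last (m + 2))) := by
  rw [pt, next_last, pos_zero, pos_of_ne _ _ last_ne last_ne_one, AffineMap.lineMap_apply_module]
  module

lemma pt_one (r s : ℝ) : Q.pt r 1 s = Q.vertex 2 +
    ((1 - s) * (1 + r * Q.ρ')) • (Q.vertex 1 - Q.vertex 2) := by
  rw [pt, CirclePolygon.finRotate_one, pos_one, pos_of_ne _ _ two_ne two_ne_one,
    AffineMap.lineMap_apply_module]
  module

/-- A point of an edge other than `0` lies either above the original chord or on one of the
extensions. -/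
lemma pt_cases {k : Fin (m + 3)} (hk : k ≠ 0) {r s : ℝ} (hr : r ∈ Set.Icc (0 : ℝ) 1)
    (hs : s ∈ Set.Icc (0 : ℝ) 1) :
    (∃ s' ∈ Set.Icc (0 : ℝ) 1, Q.pt r k s = Q.chordPoint k s' ∧
      (∀ q, Q.height r q k s =
        plHeight Q.τ (Q.a k) (Q.κ k) (Q.a (finRotate (m + 3) k)) s') ∧
      (s' = 1 → k = Fin.last (m + 2) ∨ s = 1)) ∨
    (k = Fin.last (m + 2) ∧ ∃ t, 0 < t ∧ t ≤ r * Q.ρ ∧ (t = r * Q.ρ → s = 1) ∧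
      Q.pt r k s = Q.vertex 0 + t • (Q.vertex 0 - Q.vertex (Fin.last (m + 2)))) ∨
    (k = 1 ∧ ∃ t, 0 < t ∧ t ≤ r * Q.ρ' ∧ (t = r * Q.ρ' → s = 0) ∧
      Q.pt r k s = Q.vertex 1 + t • (Q.vertex 1 - Q.vertex 2)) := by
  by_cases hke : k = Fin.last (m + 2)
  · subst hke
    have hρ : 0 ≤ r * Q.ρ := mul_nonneg hr.1 Q.ρ_pos.le
    rcases le_or_gt (s * (1 + r * Q.ρ)) 1 with h | h
    · left
      refine ⟨s * (1 + r * Q.ρ), ⟨mul_nonneg hs.1 (by linarith), h⟩, ?_, fun q => ?_,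
        fun _ => Or.inl rfl⟩
      · rw [pt_last, CirclePolygon.chordPoint_eq_combination, next_last]
        module
      · rw [height_last, next_last, Q.straight_last]
        change _ = plHeight Q.τ _ (AffineMap.lineMap _ _ Q.τ) _ _
        rw [plHeight_straight Q.τ_pos Q.τ_lt, ht_zero, ht_of_ne _ _ last_ne last_ne_one]
        simp only [AffineMap.lineMap_apply, smul_eq_mul, vsub_eq_sub, vadd_eq_add]
        ring
    · right; left
      refine ⟨rfl, s * (1 + r * Q.ρ) - 1, by linarith, ?_, fun h' => ?_, ?_⟩
      · nlinarith [hs.2]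
      · have : (s - 1) * (1 + r * Q.ρ) = 0 := by linarith
        rcases mul_eq_zero.mp this with h'' | h'' <;> linarith
      · rw [pt_last]
        module
  by_cases hk1 : k = 1
  · subst hk1
    have hρ : 0 ≤ r * Q.ρ' := mul_nonneg hr.1 Q.ρ'_pos.le
    have hs' : 0 ≤ 1 - s := by linarith [hs.2]
    rcases le_or_gt ((1 - s) * (1 + r * Q.ρ')) 1 with h | h
    · left
      refine ⟨1 - (1 - s) * (1 + r * Q.ρ'), ⟨by linarith, ?_⟩, ?_, fun q => ?_, fun h' => ?_⟩
      · linarith [mul_nonneg hs' (show 0 ≤ 1 + r * Q.ρ' by linarith)]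
      · rw [pt_one, CirclePolygon.chordPoint_eq_combination, CirclePolygon.finRotate_one]
        module
      · rw [height_one, CirclePolygon.finRotate_one, Q.straight_one]
        change _ = plHeight Q.τ _ (AffineMap.lineMap _ _ Q.τ) _ _
        rw [plHeight_straight Q.τ_pos Q.τ_lt, ht_one, ht_of_ne _ _ two_ne two_ne_one]
        simp only [AffineMap.lineMap_apply, smul_eq_mul, vsub_eq_sub, vadd_eq_add]
        ring
      · right
        have : (1 - s) * (1 + r * Q.ρ') = 0 := by linarith
        rcases mul_eq_zero.mp this with h'' | h'' <;> linarith
    · right; right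
      refine ⟨rfl, (1 - s) * (1 + r * Q.ρ') - 1, by linarith, ?_, fun h' => ?_, ?_⟩
      · nlinarith [hs.1]
      · have : s * (1 + r * Q.ρ') = 0 := by linarith
        rcases mul_eq_zero.mp this with h'' | h'' <;> linarith
      · rw [pt_one]
        module
  · left
    refine ⟨s, hs, ?_, fun q => ?_, fun h => Or.inr h⟩
    · rw [pt, pos_of_ne _ _ hk hk1, pos_of_ne _ _ (next_ne_zero hke) (next_ne_one hk)]
      rfl
    · rw [height, ht_of_ne _ _ hk hk1, ht_of_ne _ _ (next_ne_zero hke) (next_ne_one hk), kink,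
        if_neg hk, if_neg (by tauto)]

lemma one_lt_norm_ray {t : ℝ} (ht : 0 < t) :
    1 < ‖Q.vertex 0 + t • (Q.vertex 0 - Q.vertex (Fin.last (m + 2)))‖ :=
  norm_add_smul_outward (Q.norm_vertex _) (Q.norm_vertex _).le
    (fun h => last_ne (Q.vertex_injective h).symm) ht

lemma one_lt_norm_ray' {t : ℝ} (ht : 0 < t) :
    1 < ‖Q.vertex 1 + t • (Q.vertex 1 - Q.vertex 2)‖ :=
  norm_add_smul_outward (Q.norm_vertex _) (Q.norm_vertex _).le
    (fun h => two_ne_one (Q.vertex_injective h).symm) ht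

/-- Prolongation creates no crossing among these edges: inside the disk they keep the original
chords and heights, and outside there are only the two disjoint rays. -/
lemma height_ne_of_ne_zero {k l : Fin (m + 3)} (hk : k ≠ 0) (hl : l ≠ 0) (hkl : k ≠ l) {r s t : ℝ}
    (q : ℝ) (hr : r ∈ Set.Icc (0 : ℝ) 1) (hs : s ∈ Set.Ico (0 : ℝ) 1) (ht : t ∈ Set.Ico (0 : ℝ) 1)
    (h : Q.pt r k s = Q.pt r l t) : Q.height r q k s ≠ Q.height r q l t := by
  have hin : ∀ {k : Fin (m + 3)} {s : ℝ}, s ∈ Set.Icc (0 : ℝ) 1 → ‖Q.chordPoint k s‖ ≤ 1 :=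
    fun hs => Q.norm_chordPoint_le hs
  have hmul : ∀ {x : ℝ}, 0 ≤ x → r * x ≤ x := fun hx => mul_le_of_le_one_left hx hr.2
  rcases Q.pt_cases hk hr (Set.Ico_subset_Icc_self hs) with
      ⟨s', hs', e, eh, e1⟩ | ⟨rfl, s', hs0, hs1, -, e⟩ | ⟨rfl, s', hs0, hs1, -, e⟩ <;>
    rcases Q.pt_cases hl hr (Set.Ico_subset_Icc_self ht) with
      ⟨t', ht', f, fh, f1⟩ | ⟨rfl, t', ht0, ht1, -, f⟩ | ⟨rfl, t', ht0, ht1, -, f⟩ <;>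
    rw [e, f] at h
  · rcases Q.chordPoint_eq hkl hs' ht' h with h' | ⟨h1, h2, h3⟩ | ⟨h1, h2, h3⟩
    · rw [eh, fh]
      exact Q.order k l hk hl hkl _ (Q.cross k l hkl _ h'.1 _ h'.2 h) _
        (Q.cross l k hkl.symm _ h'.2 _ h'.1 h.symm)
    · rcases e1 h1 with rfl | h4
      · exact absurd (h3.trans next_last) hl
      · exact absurd h4 hs.2.ne
    · rcases f1 h2 with rfl | h4
      · exact absurd (h3.trans next_last) hk
      · exact absurd h4 ht.2.ne
  · exact absurd (hin hs') (by rw [h]; exact (Q.one_lt_norm_ray ht0).not_ge)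
  · exact absurd (hin hs') (by rw [h]; exact (Q.one_lt_norm_ray' ht0).not_ge)
  · exact absurd (hin ht') (by rw [← h]; exact (Q.one_lt_norm_ray hs0).not_ge)
  · exact absurd rfl hkl
  · exact absurd h (Q.rays s' ⟨hs0.le, hs1.trans (hmul Q.ρ_pos.le)⟩ t'
      ⟨ht0.le, ht1.trans (hmul Q.ρ'_pos.le)⟩)
  · exact absurd (hin ht') (by rw [← h]; exact (Q.one_lt_norm_ray' hs0).not_ge)
  · exact absurd h.symm (Q.rays t' ⟨ht0.le, ht1.trans (hmul Q.ρ_pos.le)⟩ s'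
      ⟨hs0.le, hs1.trans (hmul Q.ρ'_pos.le)⟩)
  · exact absurd rfl hkl

/-- The moving vertex `0` stays off the edges that do not end there. -/
lemma pos_zero_ne_pt {l : Fin (m + 3)} (hl : l ≠ 0) (hl' : l ≠ Fin.last (m + 2)) {r t : ℝ}
    (hr : r ∈ Set.Icc (0 : ℝ) 1) (ht : t ∈ Set.Icc (0 : ℝ) 1) : Q.pos r 0 ≠ Q.pt r l t := by
  intro h
  rw [pos_zero] at h
  rcases Q.pt_cases hl hr ht with ⟨t', ht', f, -⟩ | ⟨rfl, -⟩ | ⟨rfl, t', ht0, ht1, -, f⟩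
  · rw [f] at h
    rcases hr.1.eq_or_lt with rfl | hr0
    · rw [zero_mul, zero_smul, add_zero] at h
      exact Q.vertex_ne_chordPoint hl.symm (next_ne_zero hl').symm ht' h
    · exact absurd (Q.norm_chordPoint_le ht') (by
        rw [← h]; exact (Q.one_lt_norm_ray (mul_pos hr0 Q.ρ_pos)).not_ge)
  · exact hl' rfl
  · rw [f] at h
    exact Q.rays (r * Q.ρ) ⟨mul_nonneg hr.1 Q.ρ_pos.le, mul_le_of_le_one_left Q.ρ_pos.le hr.2⟩ t'
      ⟨ht0.le, ht1.trans (mul_le_of_le_one_left Q.ρ'_pos.le hr.2)⟩ h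

/-- The moving vertex `1` stays off the edges that do not end there. -/
lemma pos_one_ne_pt {l : Fin (m + 3)} (hl : l ≠ 0) (hl' : l ≠ 1) {r t : ℝ}
    (hr : r ∈ Set.Icc (0 : ℝ) 1) (ht : t ∈ Set.Icc (0 : ℝ) 1) : Q.pos r 1 ≠ Q.pt r l t := by
  intro h
  rw [pos_one] at h
  rcases Q.pt_cases hl hr ht with ⟨t', ht', f, -⟩ | ⟨rfl, t', ht0, ht1, -, f⟩ | ⟨rfl, -⟩
  · rw [f] at h
    rcases hr.1.eq_or_lt with rfl | hr0
    · rw [zero_mul, zero_smul, add_zero] at h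
      exact Q.vertex_ne_chordPoint hl'.symm (next_ne_one hl).symm ht' h
    · exact absurd (Q.norm_chordPoint_le ht') (by
        rw [← h]; exact (Q.one_lt_norm_ray' (mul_pos hr0 Q.ρ'_pos)).not_ge)
  · rw [f] at h
    exact Q.rays t' ⟨ht0.le, ht1.trans (mul_le_of_le_one_left Q.ρ_pos.le hr.2)⟩ (r * Q.ρ')
      ⟨mul_nonneg hr.1 Q.ρ'_pos.le, mul_le_of_le_one_left Q.ρ'_pos.le hr.2⟩ h.symm
  · exact hl' rfl

lemma pt_zero_right (r : ℝ) (k : Fin (m + 3)) : Q.pt r k 0 = Q.pos r k := by simp [pt]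

lemma pt_one_right (r : ℝ) (k : Fin (m + 3)) :
    Q.pt r k 1 = Q.pos r (finRotate (m + 3) k) := by simp [pt]

lemma pos_zero_ne_pos_one {r : ℝ} (hr : r ∈ Set.Icc (0 : ℝ) 1) : Q.pos r 0 ≠ Q.pos r 1 := by
  rw [← pt_zero_right Q r 1]
  exact Q.pos_zero_ne_pt one_ne last_ne_one.symm hr (by norm_num)

lemma pos_ne_next {r : ℝ} (hr : r ∈ Set.Icc (0 : ℝ) 1) (k : Fin (m + 3)) :
    Q.pos r k ≠ Q.pos r (finRotate (m + 3) k) := by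
  by_cases hk : k = 0
  · subst hk
    rw [CirclePolygon.finRotate_zero]
    exact Q.pos_zero_ne_pos_one hr
  by_cases hk1 : k = 1
  · subst hk1
    rw [CirclePolygon.finRotate_one, ← pt_zero_right Q r 2]
    exact Q.pos_one_ne_pt two_ne two_ne_one hr (by norm_num)
  by_cases hke : k = Fin.last (m + 2)
  · subst hke
    rw [next_last, pos_zero, pos_of_ne _ _ last_ne last_ne_one]
    intro h
    have h1 : (1 + r * Q.ρ) • (Q.vertex 0 - Q.vertex (Fin.last (m + 2))) = 0 := by
      rw [← sub_eq_zero] at h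
      rw [← neg_eq_zero, ← h]
      module
    have h2 : 1 + r * Q.ρ ≠ 0 := by
      have := mul_nonneg hr.1 Q.ρ_pos.le
      positivity
    have h3 := (smul_eq_zero.mp h1).resolve_left h2
    exact last_ne (Q.vertex_injective (sub_eq_zero.mp h3)).symm
  · rw [pos_of_ne _ _ hk hk1, pos_of_ne _ _ (next_ne_zero hke) (next_ne_one hk)]
    exact Q.vertex_ne k

/-- After the complete extension the edge `0` lies outside of the disk and meets no other edge. -/
lemma pt_zero_ne_of_one {l : Fin (m + 3)} (hl : l ≠ 0) {s t : ℝ} (hs : s ∈ Set.Ico (0 : ℝ) 1)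
    (ht : t ∈ Set.Ico (0 : ℝ) 1) : Q.pt 1 0 s ≠ Q.pt 1 l t := by
  intro h
  have hr : (1 : ℝ) ∈ Set.Icc (0 : ℝ) 1 := by norm_num
  -- The functional equals `C` on the whole edge `0`, is less than `C` on the disk, and increases
  -- strictly along the rays, reaching `C` only at their ends.
  have hin : inner ℝ Q.ν (Q.pt 1 0 s) = Q.C := by
    rw [pt, CirclePolygon.finRotate_zero, AffineMap.lineMap_apply_module, inner_add_right,
      inner_smul_right, inner_smul_right, pos_zero, pos_one, one_mul, one_mul, Q.inner_end,
      Q.inner_end']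
    ring
  rcases Q.pt_cases hl hr (Set.Ico_subset_Icc_self ht) with
    ⟨t', ht', f, -⟩ | ⟨rfl, t', ht0, ht1, h1, f⟩ | ⟨rfl, t', ht0, ht1, h1, f⟩
  · rw [h, f] at hin
    have := real_inner_le_norm Q.ν (Q.chordPoint l t')
    have := Q.norm_chordPoint_le (k := l) ht'
    have := Q.norm_ν_lt
    nlinarith [norm_nonneg Q.ν]
  · have e := Q.inner_end
    rw [h, f, inner_add_right, inner_smul_right] at hin
    rw [inner_add_right, inner_smul_right] at e
    have : t' = 1 * Q.ρ := by
      rw [one_mul]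
      exact mul_right_cancel₀ Q.inner_pos.ne' (by linarith)
    exact ht.2.ne (h1 this)
  · have e := Q.inner_end'
    have hin' := hin
    rw [h, f, inner_add_right, inner_smul_right] at hin
    rw [inner_add_right, inner_smul_right] at e
    have : t' = 1 * Q.ρ' := by
      rw [one_mul]
      exact mul_right_cancel₀ Q.inner_pos'.ne' (by linarith)
    rw [h1 this, pt_zero_right, ← CirclePolygon.finRotate_zero, ← pt_one_right] at h
    exact hs.2.ne (AffineMap.lineMap_injective ℝ (Q.pos_ne_next hr 0) h)

end SlidingPolygon

/-! ### Moving the bottom edge below all the others. -/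

namespace SlidingPolygon

variable {m : ℕ} (Q : SlidingPolygon m)

lemma continuous_pos (k : Fin (m + 3)) : Continuous fun r => Q.pos r k := by
  unfold pos
  split_ifs <;> fun_prop

lemma continuous_ht (k : Fin (m + 3)) : Continuous fun r => Q.ht r k := by
  unfold ht
  split_ifs <;> fun_prop

lemma continuous_kink (k : Fin (m + 3)) : Continuous fun x : ℝ × ℝ => Q.kink x.1 x.2 k := by
  unfold kink
  split_ifs
  · fun_prop
  · have h1 := (Q.continuous_ht k).comp (continuous_fst (X := ℝ) (Y := ℝ))
    have h2 := (Q.continuous_ht (finRotate (m + 3) k)).comp (continuous_fst (X := ℝ) (Y := ℝ))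
    simp only [Function.comp_def] at h1 h2
    simp only [AffineMap.lineMap_apply_module]
    exact (h1.const_smul (1 - Q.τ)).add (h2.const_smul Q.τ)
  · fun_prop

lemma kink_congr (r q q' : ℝ) {k : Fin (m + 3)} (hk : k ≠ 0) : Q.kink r q k = Q.kink r q' k := by
  simp only [kink, if_neg hk]

lemma continuous_pt (k : Fin (m + 3)) : Continuous fun x : ℝ × ℝ => Q.pt x.1 k x.2 := by
  have h1 := (Q.continuous_pos k).comp (continuous_fst (X := ℝ) (Y := ℝ))
  have h2 := (Q.continuous_pos (finRotate (m + 3) k)).comp (continuous_fst (X := ℝ) (Y := ℝ))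
  simp only [Function.comp_def] at h1 h2
  simp only [pt, AffineMap.lineMap_apply_module]
  fun_prop

lemma exists_height_bound : ∃ S > 0, ∀ r ∈ Set.Icc (0 : ℝ) 1, ∀ k, |Q.ht r k| ≤ S ∧
    ∀ q, k ≠ 0 → |Q.kink r q k| ≤ S := by
  choose B hB using fun k => isCompact_Icc.exists_bound_of_continuousOn (s := Set.Icc (0 : ℝ) 1)
    (Q.continuous_ht k).continuousOn
  choose B' hB' using fun k => isCompact_Icc.exists_bound_of_continuousOn (s := Set.Icc (0 : ℝ) 1)
    ((Q.continuous_kink k).comp (continuous_id.prodMk (continuous_const (y := (0 : ℝ))))).continuousOn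
  obtain ⟨S, hS⟩ := (Set.finite_range B).bddAbove
  obtain ⟨S', hS'⟩ := (Set.finite_range B').bddAbove
  refine ⟨max 1 (max S S'), by positivity, fun r hr k => ⟨?_, fun q hk => ?_⟩⟩
  · exact (hB k r hr).trans ((hS ⟨k, rfl⟩).trans ((le_max_left _ _).trans (le_max_right _ _)))
  · rw [Q.kink_congr r q 0 hk]
    exact (hB' k r hr).trans ((hS' ⟨k, rfl⟩).trans ((le_max_right _ _).trans (le_max_right _ _)))

lemma exists_le_norm_of_ne (f : ℝ × ℝ → R2) (hf : Continuous f)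
    (h : ∀ r ∈ Set.Icc (0 : ℝ) 1, ∀ t ∈ Set.Icc (0 : ℝ) 1, f (r, t) ≠ 0) :
    ∃ d > 0, ∀ r ∈ Set.Icc (0 : ℝ) 1, ∀ t ∈ Set.Icc (0 : ℝ) 1, d ≤ ‖f (r, t)‖ := by
  obtain ⟨p, hp, hmin⟩ := (isCompact_Icc.prod isCompact_Icc).exists_isMinOn
    ((Set.nonempty_Icc.mpr zero_le_one).prod (Set.nonempty_Icc.mpr zero_le_one))
    (f := fun p => ‖f p‖) (s := Set.Icc (0 : ℝ) 1 ×ˢ Set.Icc (0 : ℝ) 1) hf.norm.continuousOn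
  exact ⟨‖f p‖, norm_pos_iff.mpr (h _ hp.1 _ hp.2), fun r hr t ht => hmin ⟨hr, ht⟩⟩

/-- Compactness in both parameters gives one constant for the entire extension; the depth of the
kink has to be fixed before `r` varies. -/
lemma exists_separation : ∃ d > 0, ∀ r ∈ Set.Icc (0 : ℝ) 1, ∀ t ∈ Set.Icc (0 : ℝ) 1, ∀ l, l ≠ 0 →
    (l ≠ Fin.last (m + 2) → d ≤ ‖Q.pt r l t - Q.pos r 0‖) ∧
    (l ≠ 1 → d ≤ ‖Q.pt r l t - Q.pos r 1‖) := by
  have h0 : ∀ l : Fin (m + 3), ∃ d > 0, l ≠ 0 → l ≠ Fin.last (m + 2) → ∀ r ∈ Set.Icc (0 : ℝ) 1,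
      ∀ t ∈ Set.Icc (0 : ℝ) 1, d ≤ ‖Q.pt r l t - Q.pos r 0‖ := by
    intro l
    by_cases hl : l ≠ 0 ∧ l ≠ Fin.last (m + 2)
    · obtain ⟨d, hd, h⟩ := exists_le_norm_of_ne (fun x => Q.pt x.1 l x.2 - Q.pos x.1 0)
        ((Q.continuous_pt l).sub ((Q.continuous_pos 0).comp continuous_fst))
        (fun r hr t ht => sub_ne_zero.mpr (Q.pos_zero_ne_pt hl.1 hl.2 hr ht).symm)
      exact ⟨d, hd, fun _ _ => h⟩
    · exact ⟨1, one_pos, fun h1 h2 => absurd ⟨h1, h2⟩ hl⟩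
  have h1 : ∀ l : Fin (m + 3), ∃ d > 0, l ≠ 0 → l ≠ 1 → ∀ r ∈ Set.Icc (0 : ℝ) 1,
      ∀ t ∈ Set.Icc (0 : ℝ) 1, d ≤ ‖Q.pt r l t - Q.pos r 1‖ := by
    intro l
    by_cases hl : l ≠ 0 ∧ l ≠ 1
    · obtain ⟨d, hd, h⟩ := exists_le_norm_of_ne (fun x => Q.pt x.1 l x.2 - Q.pos x.1 1)
        ((Q.continuous_pt l).sub ((Q.continuous_pos 1).comp continuous_fst))
        (fun r hr t ht => sub_ne_zero.mpr (Q.pos_one_ne_pt hl.1 hl.2 hr ht).symm)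
      exact ⟨d, hd, fun _ _ => h⟩
    · exact ⟨1, one_pos, fun h1 h2 => absurd ⟨h1, h2⟩ hl⟩
  choose d hd h using h0
  choose d' hd' h' using h1
  obtain ⟨D, hD, hDle⟩ := Finite.exists_pos_le d hd
  obtain ⟨D', hD', hDle'⟩ := Finite.exists_pos_le d' hd'
  exact ⟨min D D', lt_min hD hD', fun r hr t ht l hl =>
    ⟨fun hl' => ((min_le_left _ _).trans (hDle l)).trans (h l hl hl' r hr t ht),
    fun hl' => ((min_le_right _ _).trans (hDle' l)).trans (h' l hl hl' r hr t ht)⟩⟩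

lemma exists_length_bound : ∃ L > 0, ∀ r ∈ Set.Icc (0 : ℝ) 1, ‖Q.pos r 1 - Q.pos r 0‖ ≤ L := by
  obtain ⟨L, hL⟩ := isCompact_Icc.exists_bound_of_continuousOn (s := Set.Icc (0 : ℝ) 1)
    ((Q.continuous_pos 1).sub (Q.continuous_pos 0)).continuousOn
  exact ⟨max L 1, by positivity, fun r hr => (hL r hr).trans (le_max_left _ _)⟩

/-- If the kink of the edge `0` is deep enough, then during the whole extension that edge lies below
all the others. -/
lemma exists_deep : ∃ M > 0, ∀ q ≤ -M, ∀ r ∈ Set.Icc (0 : ℝ) 1, ∀ l, l ≠ 0 →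
    ∀ s ∈ Set.Ico (0 : ℝ) 1, ∀ t ∈ Set.Ico (0 : ℝ) 1, Q.pt r 0 s = Q.pt r l t →
      Q.height r q 0 s < Q.height r q l t := by
  obtain ⟨S, hS, hb⟩ := Q.exists_height_bound
  obtain ⟨d, hd, hsep⟩ := Q.exists_separation
  obtain ⟨L, hL, hlen⟩ := Q.exists_length_bound
  -- Starting at height at most `S`, the edge falls at rate at least `-q - S` in its parameter. A
  -- crossing away from its end has parameter at least `d / L` from that end, and a rate above `2 *
  -- S * L / d` brings it below `-S` by then.
  refine ⟨S + 2 * S * L / d + 1, by positivity, fun q hq r hr l hl s hs t ht h => ?_⟩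
  have hs1 : 0 < 1 - s := by linarith [hs.2]
  have hA0 := abs_le.mp (hb r hr 0).1
  have hA1 := abs_le.mp (hb r hr 1).1
  have hτ0 := Q.τ_pos
  have hτ1 := Q.τ_lt
  have hup : ∀ x, d ≤ x * L → 2 * S < x * (-q - S) := by
    intro x hx
    have hx0 : 0 < x := by
      by_contra! h0
      nlinarith
    have h1 : 2 * S * L / d + 1 ≤ -q - S := by linarith
    have h2 : 2 * S ≤ x * (2 * S * L / d) := by
      rw [mul_div_assoc', le_div_iff₀ hd]
      nlinarith
    nlinarith
  have hlow : -S ≤ Q.height r q l t :=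
    (abs_le.mp (abs_plHeight_le hτ0 hτ1 (Set.Ico_subset_Icc_self ht) (hb r hr l).1
      ((hb r hr l).2 q hl) (hb r hr _).1)).1
  have hptl : ‖Q.pt r 0 s - Q.pos r 0‖ ≤ s * L := by
    have : Q.pt r 0 s - Q.pos r 0 = s • (Q.pos r 1 - Q.pos r 0) := by
      rw [pt, CirclePolygon.finRotate_zero, AffineMap.lineMap_apply_module]; module
    rw [this, norm_smul, Real.norm_eq_abs, abs_of_nonneg hs.1]
    exact mul_le_mul_of_nonneg_left (hlen r hr) hs.1
  have hptr : ‖Q.pt r 0 s - Q.pos r 1‖ ≤ (1 - s) * L := by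
    have : Q.pt r 0 s - Q.pos r 1 = -((1 - s) • (Q.pos r 1 - Q.pos r 0)) := by
      rw [pt, CirclePolygon.finRotate_zero, AffineMap.lineMap_apply_module]; module
    rw [this, norm_neg, norm_smul, Real.norm_eq_abs, abs_of_nonneg hs1.le]
    exact mul_le_mul_of_nonneg_left (hlen r hr) hs1.le
  have hqS : 0 < -q - S := by
    have : 0 ≤ 2 * S * L / d := by positivity
    linarith
  have hkink : Q.kink r q 0 = q := if_pos rfl
  rcases le_total s Q.τ with hsτ | hsτ
  · -- the descending part
    have hz : Q.height r q 0 s ≤ Q.ht r 0 - s * (-q - S) := by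
      rw [height, plHeight_of_le _ _ _ hsτ, hkink]
      have h1 : s ≤ s / Q.τ := by
        rw [le_div_iff₀ hτ0]
        nlinarith [hs.1]
      nlinarith [hs.1]
    -- The last edge may overlap the edge `0` in projection up to their common vertex, where the
    -- parameter has no lower bound. There the slopes are compared, using that the ratio of the
    -- distances to the vertex, `s / (1 - t)`, is at least `d / L`.
    by_cases hle : l = Fin.last (m + 2)
    · subst hle
      have ht1 : 0 < 1 - t := by linarith [ht.2]
      have hd1 : d ≤ ‖Q.pos r (Fin.last (m + 2)) - Q.pos r 0‖ := by
        obtain ⟨k, hk⟩ := (finRotate (m + 3)).surjective (Fin.last (m + 2))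
        have hk0 : k ≠ 0 := by
          rintro rfl
          rw [CirclePolygon.finRotate_zero] at hk
          exact last_ne_one hk.symm
        have hke : k ≠ Fin.last (m + 2) := by
          rintro rfl
          exact Q.finRotate_ne _ hk
        have := (hsep r hr 1 (by norm_num) k hk0).1 hke
        rwa [pt_one_right, hk] at this
      have hlen' : d ≤ s / (1 - t) * L := by
        have e : Q.pt r (Fin.last (m + 2)) t - Q.pos r 0 =
            (1 - t) • (Q.pos r (Fin.last (m + 2)) - Q.pos r 0) := by
          rw [pt, next_last, AffineMap.lineMap_apply_module]; module
        rw [h, e, norm_smul, Real.norm_eq_abs, abs_of_pos ht1] at hptl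
        rw [div_mul_eq_mul_div, le_div_iff₀ ht1]
        nlinarith
      have h2 := hup _ hlen'
      rw [div_mul_eq_mul_div, lt_div_iff₀ ht1] at h2
      have hAe := abs_le.mp (hb r hr (Fin.last (m + 2))).1
      rw [height_last, AffineMap.lineMap_apply, smul_eq_mul, vsub_eq_sub, vadd_eq_add]
      nlinarith
    · have h1 := ((hsep r hr t (Set.Ico_subset_Icc_self ht) l hl).1 hle)
      rw [← h] at h1
      have := hup s (h1.trans hptl)
      linarith
  · have hz : Q.height r q 0 s ≤ Q.ht r 1 - (1 - s) * (-q - S) := by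
      rw [height, plHeight_of_ge hτ0 hτ1 _ _ _ hsτ, hkink, CirclePolygon.finRotate_zero]
      have h1 : 1 - s ≤ (1 - s) / (1 - Q.τ) := by
        rw [le_div_iff₀ (by linarith)]
        nlinarith
      nlinarith
    by_cases hl1 : l = 1
    · subst hl1
      have hA2 := abs_le.mp (hb r hr 2).1
      have h2 : 2 * S * t < (1 - s) * (-q - S) := by
        rcases ht.1.eq_or_lt with rfl | ht0
        · rw [mul_zero]
          exact mul_pos hs1 hqS
        · have hd1 := (hsep r hr 0 (by norm_num) 2 two_ne).2 two_ne_one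
          rw [pt_zero_right] at hd1
          have e : Q.pt r 1 t - Q.pos r 1 = t • (Q.pos r 2 - Q.pos r 1) := by
            rw [pt, CirclePolygon.finRotate_one, AffineMap.lineMap_apply_module]; module
          rw [h, e, norm_smul, Real.norm_eq_abs, abs_of_pos ht0] at hptr
          have hlen' : d ≤ (1 - s) / t * L := by
            rw [div_mul_eq_mul_div, le_div_iff₀ ht0]
            nlinarith
          have h2 := hup _ hlen'
          rwa [div_mul_eq_mul_div, lt_div_iff₀ ht0] at h2
      rw [height_one, AffineMap.lineMap_apply, smul_eq_mul, vsub_eq_sub, vadd_eq_add]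
      nlinarith [ht.1]
    · have h1 := ((hsep r hr t (Set.Ico_subset_Icc_self ht) l hl).2 hl1)
      rw [← h] at h1
      have := hup (1 - s) (h1.trans hptr)
      linarith

lemma kinkGeneric {r q : ℝ} (hr : r ∈ Set.Icc (0 : ℝ) 1)
    (h : ∀ l, l ≠ 0 → ∀ s ∈ Set.Ico (0 : ℝ) 1, ∀ t ∈ Set.Ico (0 : ℝ) 1,
      Q.pt r 0 s = Q.pt r l t → Q.height r q 0 s ≠ Q.height r q l t) :
    KinkGeneric (Q.pos r) Q.τ (Q.ht r) (Q.kink r q) := by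
  refine ⟨Q.pos_ne_next hr, fun k l hkl s hs t ht hst => ?_⟩
  by_cases hk : k = 0
  · subst hk
    exact h l (Ne.symm hkl) s hs t ht hst
  by_cases hl : l = 0
  · subst hl
    exact (h k hk t ht s hs hst.symm).symm
  · exact Q.height_ne_of_ne_zero hk hl hkl q hr hs ht hst

/-- The polygon with kinks after the extension by the fraction `r`. -/
noncomputable def knot (r q : ℝ) : Set R3 :=
  polygonSet (kinkPerm (m + 3)) (kinkPolygon (Q.pos r) Q.τ (Q.ht r) (Q.kink r q))

/-- If the edge `0` can be pulled down without crossings, the whole polygon is equivalent to the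
completely extended one. -/
lemma knotEquiv_knot {q₀ : ℝ} (h : ∀ q ≤ q₀, ∀ l, l ≠ 0 → ∀ s ∈ Set.Ico (0 : ℝ) 1,
      ∀ t ∈ Set.Ico (0 : ℝ) 1, Q.pt 0 0 s = Q.pt 0 l t → Q.height 0 q 0 s ≠ Q.height 0 q l t)
    (q₁ : ℝ) : KnotEquiv (Q.knot 0 q₀) (Q.knot 1 q₁) := by
  obtain ⟨M, -, hM⟩ := Q.exists_deep
  have hmove : ∀ S : Set (ℝ × ℝ), IsPreconnected S →
      (∀ x ∈ S, KinkGeneric (Q.pos x.1) Q.τ (Q.ht x.1) (Q.kink x.1 x.2)) →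
      ∀ x ∈ S, ∀ y ∈ S, KnotEquiv (Q.knot x.1 x.2) (Q.knot y.1 y.2) := by
    intro S hS hg x hx y hy
    refine knotEquiv_of_continuous_isSimplePolygon hS
      (q := fun x : ℝ × ℝ => kinkPolygon (Q.pos x.1) Q.τ (Q.ht x.1) (Q.kink x.1 x.2))
      (continuousOn_kinkPolygon (fun k => ?_) (fun k => ?_) (fun k => ?_))
      (fun x hx => (hg x hx).isSimplePolygon Q.τ_pos Q.τ_lt) hx hy
    · exact ((Q.continuous_pos k).comp continuous_fst).continuousOn
    · exact ((Q.continuous_ht k).comp continuous_fst).continuousOn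
    · exact (Q.continuous_kink k).continuousOn
  -- The three moves are lowering the kink, extending with the kink held fixed, and releasing the
  -- kink. In the last one any height is allowed, as the edge `0` meets no other half-open edge in
  -- projection.
  have e1 : KnotEquiv (Q.knot 0 q₀) (Q.knot 0 (min q₀ (-M))) := by
    refine hmove ({0} ×ˢ Set.Iic q₀) (isPreconnected_singleton.prod isPreconnected_Iic) ?_
      (0, q₀) ⟨rfl, Set.mem_Iic.mpr le_rfl⟩ (0, min q₀ (-M)) ⟨rfl, Set.mem_Iic.mpr (min_le_left _ _)⟩
    rintro ⟨r, q⟩ ⟨rfl, hq⟩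
    exact Q.kinkGeneric (by norm_num) (h q hq)
  have e2 : KnotEquiv (Q.knot 0 (min q₀ (-M))) (Q.knot 1 (min q₀ (-M))) := by
    refine hmove (Set.Icc 0 1 ×ˢ {min q₀ (-M)}) (isPreconnected_Icc.prod isPreconnected_singleton)
      ?_ (0, _) ⟨by norm_num, rfl⟩ (1, _) ⟨by norm_num, rfl⟩
    rintro ⟨r, q⟩ ⟨hr, rfl⟩
    exact Q.kinkGeneric hr fun l hl s hs t ht hst =>
      (hM _ (min_le_right _ _) r hr l hl s hs t ht hst).ne
  have e3 : KnotEquiv (Q.knot 1 (min q₀ (-M))) (Q.knot 1 q₁) := by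
    refine hmove ({1} ×ˢ Set.univ) (isPreconnected_singleton.prod isPreconnected_univ) ?_
      (1, _) ⟨rfl, trivial⟩ (1, q₁) ⟨rfl, trivial⟩
    rintro ⟨r, q⟩ ⟨rfl, -⟩
    exact Q.kinkGeneric (by norm_num) fun l hl s hs t ht hst =>
      absurd hst (Q.pt_zero_ne_of_one hl hs ht)
  exact e1.trans (e2.trans e3)

/-- The completely extended polygon is a stick knot. -/
lemma isStickKnot_knot (cut : Finset (Fin (m + 3)))
    (hcut : ∀ k ∉ cut, k ≠ 0 →
      Q.κ k = AffineMap.lineMap (Q.a k) (Q.a (finRotate (m + 3) k)) (1 - Q.c / 2))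
    (hK : IsKnot (Q.knot 1 (AffineMap.lineMap (Q.ht 1 0) (Q.ht 1 1) Q.τ))) :
    IsStickKnot (m + 3 + cut.card)
      (Q.knot 1 (AffineMap.lineMap (Q.ht 1 0) (Q.ht 1 1) Q.τ)) := by
  refine KinkGeneric.isStickKnot Q.τ_pos Q.τ_lt (Q.kinkGeneric (by norm_num)
    fun l hl s hs t ht hst => absurd hst (Q.pt_zero_ne_of_one hl hs ht)) cut (fun k hk => ?_) hK
  by_cases h0 : k = 0
  · subst h0
    rw [kink, if_pos rfl, CirclePolygon.finRotate_zero]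
  by_cases h1 : k = 1 ∨ k = Fin.last (m + 2)
  · rw [kink, if_neg h0, if_pos h1]
  · rw [kink, if_neg h0, if_neg h1, hcut k hk h0]
    push Not at h1
    rw [ht_of_ne _ _ h0 h1.1, ht_of_ne _ _ (next_ne_zero h1.2) (next_ne_one h0), τ]

end SlidingPolygon

/-! ### From the diagram to the stick knot. -/

lemma norm_overPoint_sub (p p' : R2) (z : ℝ) : ‖overPoint p z - overPoint p' z‖ = ‖p - p'‖ := by
  simp [EuclideanSpace.norm_eq, overPoint, Fin.sum_univ_succ]

lemma norm_kinkPolygon_sub_le {n : ℕ} {P P' : Fin n → R2} {τ δ : ℝ} (h0 : 0 ≤ τ) (h1 : τ ≤ 1)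
    (a κ : Fin n → ℝ) (h : ∀ k, ‖P' k - P k‖ ≤ δ) (i : Fin n × Bool) :
    ‖kinkPolygon P' τ a κ i - kinkPolygon P τ a κ i‖ ≤ δ := by
  rcases i with ⟨k, _ | _⟩
  · rw [kinkPolygon_false, kinkPolygon_false, norm_overPoint_sub]
    exact h k
  · rw [kinkPolygon_true, kinkPolygon_true, norm_overPoint_sub]
    have e : AffineMap.lineMap (P' k) (P' (finRotate n k)) τ -
        AffineMap.lineMap (P k) (P (finRotate n k)) τ =
        (1 - τ) • (P' k - P k) + τ • (P' (finRotate n k) - P (finRotate n k)) := by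
      rw [AffineMap.lineMap_apply_module, AffineMap.lineMap_apply_module]; module
    rw [e]
    refine (norm_add_le _ _).trans ?_
    rw [norm_smul, norm_smul, Real.norm_eq_abs, Real.norm_eq_abs, abs_of_nonneg h0,
      abs_of_nonneg (by linarith)]
    nlinarith [h k, h (finRotate n k)]

/-- Over `[c, 1 - c]` at least the fraction `c` of the kink's depth is felt, and `c * q ≤ -(2 * S +
1)` outweighs a starting height of at most `S`. -/
lemma plHeight_lt_of_deep {c S a b q s : ℝ} (hc : 0 < c) (hS : 0 < S) (ha : |a| ≤ S)
    (hq : q ≤ -((2 * S + 1) / c)) (hs : s ∈ Set.Icc c (1 - c)) :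
    plHeight (1 - c / 2) a q b s < -S := by
  have h1 : c < 1 := by linarith [hs.1, hs.2]
  rw [plHeight_of_le _ _ _ (by linarith [hs.2])]
  have hx1 : s / (1 - c / 2) ≤ 1 := (div_le_one (by linarith)).mpr (by linarith [hs.2])
  have hx2 : c ≤ s / (1 - c / 2) := by
    rw [le_div_iff₀ (by linarith)]
    nlinarith [hs.1]
  generalize s / (1 - c / 2) = x at *
  have h2 : c * q ≤ -(2 * S + 1) := by
    have := mul_le_mul_of_nonneg_left hq hc.le
    rwa [mul_neg, mul_div_cancel₀ _ hc.ne'] at this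
  have h3 : q < 0 := lt_of_le_of_lt hq (neg_lt_zero.mpr (by positivity))
  obtain ⟨ha1, ha2⟩ := abs_le.mp ha
  nlinarith

namespace SlidingPolygon

variable {m : ℕ} (Q : SlidingPolygon m)

lemma pos_zero_left : Q.pos 0 = Q.vertex := by
  ext1 k
  unfold pos
  split_ifs with h0 h1
  · simp [h0]
  · simp [h1]
  · rfl

lemma ht_zero_left : Q.ht 0 = Q.a := by
  ext1 k
  unfold ht
  split_ifs with h0 h1
  · simp [h0]
  · simp [h1]
  · rfl

lemma kink_zero_left (q : ℝ) : Q.kink 0 q = Function.update Q.κ 0 q := by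
  ext1 k
  by_cases h0 : k = 0
  · subst h0
    simp [kink]
  rw [Function.update_of_ne h0, kink, if_neg h0, ht_zero_left]
  split_ifs with h1
  · rcases h1 with rfl | rfl
    · rw [Q.straight_one, CirclePolygon.finRotate_one, τ]
    · rw [Q.straight_last, next_last, τ]
  · rfl

end SlidingPolygon

namespace ArcPresentation

/-- The passage from knots over a diagram, compared by vertical maps, to polygons in space, compared
by moving vertices. -/
lemma lift_plHeight {n : ℕ} (D : ArcPresentation n) {τ : ℝ} (h0 : 0 < τ) (h1 : τ < 1)
    (a κ : Fin n → ℝ) : D.lift (fun k => plHeight τ (a k) (κ k) (a (finRotate n k))) =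
      polygonSet (kinkPerm n) (kinkPolygon D.vertex τ a κ) := by
  ext x
  rw [mem_polygonSet_kink h0 h1]
  constructor
  · rintro ⟨k, r, hr, rfl⟩
    exact ⟨k, r, hr, rfl⟩
  · rintro ⟨k, r, hr, rfl⟩
    exact ⟨k, r, hr, rfl⟩

/-- A diagram with `m + 3` chords whose bottom chord is traversed first represents a stick knot with
at most `m + 3 + m / 2` sticks. -/
lemma exists_isStickKnot {m : ℕ} (D : ArcPresentation (m + 3)) (h0 : D.label 0 = 0) {K : Set R3}
    (hK : IsKnot K) (hD : D.Represents K) :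
    ∃ j, 2 * j ≤ m ∧ ∃ L, IsStickKnot (m + 3 + j) L ∧ KnotEquiv K L := by
  -- The constant is valid for all inscribed polygons within distance `c`, so the heights derived
  -- from it also suit the perturbed polygon chosen later.
  obtain ⟨c, hc, hc1, hcross⟩ := D.circlePolygon.exists_crossing_bound
  obtain ⟨a, κ, cut, hcard, hcut0, hcut1, hcutl, hstraight, horder⟩ :=
    exists_heights m D.label hc hc1
  obtain ⟨S, hS, hSa, hSκ⟩ : ∃ S > 0, (∀ k, |a k| ≤ S) ∧ ∀ k, |κ k| ≤ S := by
    obtain ⟨A, hA⟩ := (Set.finite_range fun k => |a k|).bddAbove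
    obtain ⟨B, hB⟩ := (Set.finite_range fun k => |κ k|).bddAbove
    exact ⟨max 1 (max A B), by positivity,
      fun k => (hA ⟨k, rfl⟩).trans ((le_max_left _ _).trans (le_max_right _ _)),
      fun k => (hB ⟨k, rfl⟩).trans ((le_max_right _ _).trans (le_max_right _ _))⟩
  have hτ0 : 0 < 1 - c / 2 := by linarith
  have hτ1 : 1 - c / 2 < 1 := by linarith
  set q₀ := -((2 * S + 1) / c) with hq₀
  have hdeep : ∀ q ≤ q₀, ∀ b b' x l, ∀ s ∈ Set.Icc c (1 - c), ∀ t ∈ Set.Icc (0 : ℝ) 1,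
      b' = a (finRotate (m + 3) l) → x = κ l →
      plHeight (1 - c / 2) (a 0) q b s < plHeight (1 - c / 2) (a l) x b' t := by
    rintro q hq b b' x l s hs t ht rfl rfl
    exact (plHeight_lt_of_deep hc hS (hSa 0) hq hs).trans_le
      (abs_le.mp (abs_plHeight_le hτ0 hτ1 ht (hSa _) (hSκ _) (hSa _))).1
  have hne : ∀ k l, k ≠ 0 → l ≠ 0 → k ≠ l → ∀ s ∈ Set.Icc c (1 - c), ∀ t ∈ Set.Icc c (1 - c),
      plHeight (1 - c / 2) (a k) (κ k) (a (finRotate (m + 3) k)) s ≠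
        plHeight (1 - c / 2) (a l) (κ l) (a (finRotate (m + 3) l)) t := by
    intro k l hk hl hkl s hs t ht
    rcases lt_trichotomy (D.label k) (D.label l) with h | h | h
    · exact (horder k l hk hl h s hs t ht).ne
    · exact absurd (D.label.injective h) hkl
    · exact (horder l k hl hk h t ht s hs).ne'
  have hbottom : ∀ D' : CirclePolygon (m + 3), (∀ k, ‖D'.vertex k - D.vertex k‖ ≤ c) →
      ∀ q ≤ q₀, ∀ l, l ≠ 0 → ∀ s ∈ Set.Ico (0 : ℝ) 1, ∀ t ∈ Set.Ico (0 : ℝ) 1,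
      D'.chordPoint 0 s = D'.chordPoint l t →
      plHeight (1 - c / 2) (a 0) q (a 1) s <
        plHeight (1 - c / 2) (a l) (κ l) (a (finRotate (m + 3) l)) t := by
    intro D' hD' q hq l hl s hs t ht h
    rcases D'.chordPoint_eq hl.symm (Set.Ico_subset_Icc_self hs) (Set.Ico_subset_Icc_self ht) h
      with h' | h' | h'
    · exact hdeep q hq _ _ _ l s (hcross D' hD' _ _ hl.symm _ h'.1 _ h'.2 h) t
        (Set.Ico_subset_Icc_self ht) rfl rfl
    · exact absurd h'.1 hs.2.ne
    · exact absurd h'.2.1 ht.2.ne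
  set κ' := Function.update κ 0 q₀ with hκ'
  have hκ0 : κ' 0 = q₀ := Function.update_self ..
  have hκl : ∀ l, l ≠ 0 → κ' l = κ l := fun l hl => Function.update_of_ne hl ..
  have hself : ∀ k, ‖D.circlePolygon.vertex k - D.vertex k‖ ≤ c := fun k => by
    change ‖D.vertex k - D.vertex k‖ ≤ c
    simpa using hc.le
  have hheight : D.IsHeight
      (fun k => plHeight (1 - c / 2) (a k) (κ' k) (a (finRotate (m + 3) k))) := by
    refine ⟨fun k => (continuous_plHeight hτ0 hτ1 _ _ _).continuousOn, fun k => ?_,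
      fun k l hkl s hs t ht h => ?_⟩
    · rw [plHeight_one hτ0 hτ1, plHeight_zero hτ0]
    · have hkl' : k ≠ l := by rintro rfl; exact lt_irrefl _ hkl
      have hl : l ≠ 0 := by
        rintro rfl
        rw [h0] at hkl
        exact absurd hkl (Fin.not_lt_zero _)
      have hs' := hcross _ hself _ _ hkl' s hs t ht h
      have ht' := hcross _ hself _ _ hkl'.symm t ht s hs h.symm
      rw [hκl l hl]
      by_cases hk : k = 0
      · subst hk
        rw [hκ0]
        exact hdeep q₀ le_rfl _ _ _ l s hs' t (Set.Ioo_subset_Icc_self ht) rfl rfl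
      · rw [hκl k hk]
        exact horder k l hk hl hkl s hs' t ht'
  have hgen : KinkGeneric D.vertex (1 - c / 2) a κ' := by
    refine ⟨D.vertex_ne, fun k l hkl s hs t ht h => ?_⟩
    by_cases hk : k = 0
    · subst hk
      rw [hκ0, hκl l (Ne.symm hkl)]
      exact (hbottom _ hself q₀ le_rfl l (Ne.symm hkl) s hs t ht h).ne
    by_cases hl : l = 0
    · subst hl
      rw [hκ0, hκl k hk]
      exact (hbottom _ hself q₀ le_rfl k hk t ht s hs h.symm).ne'
    rw [hκl k hk, hκl l hl]
    rcases D.circlePolygon.chordPoint_eq hkl (Set.Ico_subset_Icc_self hs)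
      (Set.Ico_subset_Icc_self ht) h with h' | h' | h'
    · exact hne k l hk hl hkl s (hcross _ hself _ _ hkl _ h'.1 _ h'.2 h) t
        (hcross _ hself _ _ hkl.symm _ h'.2 _ h'.1 h.symm)
    · exact absurd h'.1 hs.2.ne
    · exact absurd h'.2.1 ht.2.ne
  -- From here on only the polygon in space is moved; its projection need no longer be a diagram
  -- with double points.
  obtain ⟨δ, hδ, hclose⟩ := (hgen.isSimplePolygon hτ0 hτ1).exists_knotEquiv_of_close
  obtain ⟨D', hD', hanti⟩ := D.circlePolygon.exists_close_not_antiparallel (lt_min hδ hc)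
  have hD'c : ∀ k, ‖D'.vertex k - D.vertex k‖ ≤ c := fun k => (hD' k).trans (min_le_right _ _)
  obtain ⟨ν, C, ρ, ρ', hν, hρ, hρ', e1, e2, p1, p2, hrays⟩ := exists_outer_segment
    (D'.norm_vertex 0) (D'.norm_vertex 1) (D'.norm_vertex (Fin.last (m + 2))).le
    (D'.norm_vertex 2).le (fun h => SlidingPolygon.last_ne (D'.vertex_injective h).symm)
    (fun h => SlidingPolygon.two_ne_one (D'.vertex_injective h).symm)
    (fun h => SlidingPolygon.one_ne (D'.vertex_injective h).symm) hanti
  let Q : SlidingPolygon m :=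
    { toCirclePolygon := D'
      a := a
      κ := κ
      c := c
      c_pos := hc
      c_le := hc1
      cross := hcross D' hD'c
      order := hne
      straight_one := by
        rw [hstraight 1 hcut1 SlidingPolygon.one_ne, CirclePolygon.finRotate_one]
      straight_last := by
        rw [hstraight _ hcutl SlidingPolygon.last_ne, SlidingPolygon.next_last]
      ν := ν
      C := C
      ρ := ρ
      ρ' := ρ'
      norm_ν_lt := hν
      ρ_pos := hρ
      ρ'_pos := hρ'
      inner_end := e1
      inner_end' := e2
      inner_pos := p1
      inner_pos' := p2
      rays := hrays }
  have hequiv : ∀ q₁, KnotEquiv K (Q.knot 1 q₁) := by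
    intro q₁
    -- The chain runs from the given knot over the diagram to the broken-line lift, then to the
    -- perturbed polygon, then to the extended one.
    obtain ⟨z, hz, hKz⟩ := hD
    have s1 := hKz.trans (hz.knotEquiv hheight)
    rw [D.lift_plHeight hτ0 hτ1] at s1
    have s2 := s1.trans (hclose (kinkPolygon D'.vertex (1 - c / 2) a κ')
      (norm_kinkPolygon_sub_le hτ0.le hτ1.le a κ' fun k => (hD' k).trans (min_le_left _ _)))
    have s3 : Q.knot 0 q₀ =
        polygonSet (kinkPerm (m + 3)) (kinkPolygon D'.vertex (1 - c / 2) a κ') := by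
      rw [SlidingPolygon.knot, Q.pos_zero_left, Q.ht_zero_left, Q.kink_zero_left]
      rfl
    rw [← s3] at s2
    refine s2.trans (Q.knotEquiv_knot (fun q hq l hl s hs t ht h => ?_) q₁)
    rw [SlidingPolygon.pt, SlidingPolygon.pt, Q.pos_zero_left] at h
    have := hbottom D' hD'c q hq l hl s hs t ht h
    rw [SlidingPolygon.height, SlidingPolygon.height, Q.ht_zero_left, Q.kink_zero_left,
      Function.update_self, Function.update_of_ne hl, CirclePolygon.finRotate_zero]
    exact this.ne
  exact ⟨cut.card, hcard, _, Q.isStickKnot_knot cut hstraight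
    (hK.of_knotEquiv (hequiv _)), hequiv _⟩

/-- The same diagram, traversed from another vertex. -/
def rotate {m : ℕ} (D : ArcPresentation (m + 3)) (i : Fin (m + 3)) : ArcPresentation (m + 3) where
  three_le := D.three_le
  vertex k := D.vertex (k + i)
  norm_vertex k := D.norm_vertex _
  vertex_injective _ _ h := add_right_cancel (D.vertex_injective h)
  label := (Equiv.addRight i).trans D.label
  no_triple_point k l p hkl hkp hlp := by
    have e : ∀ k, finRotate (m + 3) k + i = finRotate (m + 3) (k + i) := fun k => by
      rw [finRotate_apply, finRotate_apply, add_right_comm]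
    rw [e, e, e]
    exact D.no_triple_point _ _ _ (fun h => hkl (add_right_cancel h))
      (fun h => hkp (add_right_cancel h)) (fun h => hlp (add_right_cancel h))

lemma chordPoint_rotate {m : ℕ} (D : ArcPresentation (m + 3)) (i k : Fin (m + 3)) (t : ℝ) :
    (D.rotate i).chordPoint k t = D.chordPoint (k + i) t := by
  have e : finRotate (m + 3) k + i = finRotate (m + 3) (k + i) := by
    rw [finRotate_apply, finRotate_apply, add_right_comm]
  simp only [chordPoint, rotate]
  rw [e]

lemma Represents.rotate {m : ℕ} {D : ArcPresentation (m + 3)} {K : Set R3} (h : D.Represents K)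
    (i : Fin (m + 3)) : (D.rotate i).Represents K := by
  obtain ⟨z, hz, hK⟩ := h
  refine ⟨fun k => z (k + i), ⟨fun k => hz.continuousOn _, fun k => ?_, fun k l hkl s hs t ht h => ?_⟩,
    ?_⟩
  · rw [hz.closes_up, finRotate_apply, finRotate_apply, add_right_comm]
  · rw [chordPoint_rotate, chordPoint_rotate] at h
    exact hz.under_over _ _ hkl s hs t ht h
  · convert hK using 1
    ext x
    constructor
    · rintro ⟨k, t, ht, rfl⟩
      exact ⟨k + i, t, ht, by rw [chordPoint_rotate]⟩
    · rintro ⟨k, t, ht, rfl⟩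
      exact ⟨k - i, t, ht, by beta_reduce; rw [chordPoint_rotate, sub_add_cancel]⟩

end ArcPresentation

/-- A knot with an arc presentation with `n` chords is equivalent to a stick knot with at most
`3 (n - 1) / 2` sticks. -/
lemma exists_isStickKnot_of_represents {n : ℕ} {K : Set R3} (hK : IsKnot K) (D : ArcPresentation n)
    (hD : D.Represents K) : ∃ s, 2 * s + 3 ≤ 3 * n ∧ ∃ L, IsStickKnot s L ∧ KnotEquiv K L := by
  obtain ⟨m, rfl⟩ : ∃ m, n = m + 3 := ⟨n - 3, by have := D.three_le; omega⟩
  obtain ⟨j, hj, h⟩ := (D.rotate (D.label.symm 0)).exists_isStickKnot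
    (by simp [ArcPresentation.rotate]) hK (hD.rotate _)
  -- The count is `2 * (m + 3 + j) + 3 ≤ 3 * m + 9 = 3 * n`.
  exact ⟨m + 3 + j, by omega, h⟩

theorem theorem3 (K : Set R3) (hK : IsKnot K) (hnontrivial : ¬ IsTrivialKnot K) :
    (stickNumber K : ENNReal) ≤ 3 / 2 * ((arcIndex K : ENNReal) - 1) := by
  by_cases hex : ∃ n, ∃ D : ArcPresentation n, D.Represents K
  swap
  · have : arcIndex K = ⊤ := by
      unfold arcIndex
      refine iInf_eq_top.mpr fun n => iInf_eq_top.mpr fun h => absurd ⟨n, h⟩ hex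
    rw [this]
    simp [ENNReal.mul_top]
  classical
  have harc : arcIndex K = Nat.find hex := by
    refine le_antisymm (iInf₂_le
      (f := fun (n : ℕ) (_ : ∃ D : ArcPresentation n, D.Represents K) => (n : ℕ∞)) _
      (Nat.find_spec hex)) (le_iInf₂ fun n hn => ?_)
    exact_mod_cast Nat.find_min' hex hn
  obtain ⟨D, hD⟩ := Nat.find_spec hex
  obtain ⟨s, hs, hL⟩ := exists_isStickKnot_of_represents hK D hD
  have hstick : stickNumber K ≤ s := iInf₂_le s hL
  rw [harc]
  generalize Nat.find hex = n at hs
  obtain ⟨p, rfl⟩ : ∃ p, n = p + 1 := ⟨n - 1, by omega⟩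
  have h1 : (stickNumber K : ENNReal) ≤ (s : ENNReal) := by
    simpa using ENat.toENNReal_le.mpr hstick
  refine h1.trans ?_
  have h2 : (((p + 1 : ℕ) : ℕ∞) : ENNReal) - 1 = (p : ENNReal) := by
    simp
  -- Doubling clears the fraction and leaves an inequality between natural numbers, free of
  -- truncated subtraction because `n = p + 1`.
  rw [h2, ← ENNReal.mul_le_mul_iff_right (a := 2) (by norm_num) (by norm_num), ← mul_assoc,
    ENNReal.mul_div_cancel (by norm_num) (by norm_num)]
  exact_mod_cast (by omega : 2 * s ≤ 3 * p)
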